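/- **Theorem (Central Limit Theorem).** Write $|x|_1=\sum_i|x_i|$ for vectors and $|M|_1=\max_q\sum_p|M^{(p,q)}|$ for matrices. *Process.* Let $(\varepsilon_t)_{t\in\mathbb Z}$ be i.i.d. $\mathbb R^d$-valued random vectors with $E|\varepsilon_1|_1<\infty$ and $E\varepsilon_1=0$, and for $T\ge 1$, $1\le t\le T$ let $$X_{t,T}=\mu(t/T)+\sum_{j\in\mathbb Z}A_{t,T}(j)\,\varepsilon_{t-j},\qquad \widetilde X_t(u)=\mu(u)+\sum_{j\in\mathbb Z}A(u,j)\,\varepsilon_{t-j}\quad(t\in\mathbb Z,\ u\in[0,1]),$$ where $\mu:[0,1]\to\mathbb R^d$ is componentwise continuously differentiable, $A_{t,T}(j)\in\mathbb R^{d\times d}$, each $A(\cdot,j)=(a^{(p,q)}(\cdot,j))_{p,q}:[0,1]\to\mathbb R^{d\times d}$ is entrywise continuously differentiable, and for some $\vartheta\in(0,1)$, $B<\infty$ and all $j\in\mathbb Z$, $p,q\in\{1,\dots,d\}$, $$\sup_{t\le T}|A_{t,T}(j)|_1\le B\vartheta^{|j|},\quad \sup_{u}|a^{(p,q)}(u,j)|\le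 B\vartheta^{|j|},\quad \sup_u|\partial_u a^{(p,q)}(u,j)|\le B\vartheta^{|j|},\quad \sup_{t\le T}T\,|A_{t,T}(j)-A(t/T,j)|_1\le B\vartheta^{|j|}.$$ For $M\in\{1,2,\dots\}$ let $X^{(M)}_{t,T}$ and $\widetilde X^{(M)}_t(u)$ be defined by the same formulas with the sums restricted to $|j|<M$. *Weights.* Let $w_{t,T}\ge 0$ ($1\le t\le T$), let $d_T$ be the number of $t\in\{1,\dots,T\}$ with $w_{t,T}\neq 0$, and assume $d_T\to\infty$ as $T\to\infty$ and $w_{t,T}\le C_w d_T^{-1/2}$ for all $1\le t\le T$ and some constant $C_w<\infty$. Put $w_{t,T}:=w_{1,T}$ for $t<1$ and $w_{t,T}:=w_{T,T}$ for $t>T$. *Function.* Let $(\mathcal S,\rho)$ be a compact semimetric space with $\mathcal S\subseteq\overline{\mathbb R}^d$ and let $f:\mathcal S\times\mathbb R^d\to\mathbb R$ satisfy $|f(s,x)-f(s,x^\circ)|\le C_{Lip}|x-x^\circ|_1$ for all $s\in\mathcal S$, $x,x^\circ\in\mathbb R^d$, and, for some $\delta\in(0,1/2)$, $$\sup_{t\le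 T,\,s\in\mathcal S,\,M\ge1}E\big[|f(s,X_{t,T})|^{2+\delta}+|f(s,X^{(M)}_{t,T})|^{2+\delta}\big]<\infty,\qquad \sup_{u\in[0,1],\,s\in\mathcal S,\,M\ge1}E\big[|f(s,\widetilde X_0(u))|^{2+\delta}+|f(s,\widetilde X^{(M)}_0(u))|^{2+\delta}\big]<\infty.$$ *Conclusion.* Let $J\in\mathbb N$ and $s_1,\dots,s_J\in\mathcal S$ be such that for all $i,j\in\{1,\dots,J\}$ and $h\in\mathbb Z$ the limit $$\gamma_h(s_i,s_j)=\lim_{T\to\infty}\sum_{t=1}^T w_{t,T}\,w_{t+h,T}\,\operatorname{Cov}\big(f(s_i,\widetilde X_0(t/T)),\,f(s_j,\widetilde X_h(t/T))\big)$$ exists in $\mathbb R$. Then $\sum_{h\in\mathbb Z}\gamma_h(s_i,s_j)$ converges absolutely for all $i,j$, the matrix $\mathbf V=\big(\sum_{h\in\mathbb Z}\gamma_h(s_i,s_j)\big)_{i,j=1,\dots,J}$ is symmetric and positive semidefinite, and $$\Big(\sum_{t=1}^T w_{t,T}\big(f(s_j,X_{t,T})-E f(s_j,X_{t,T})\big)\Big)_{j=1,\dots,J}\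 \overset{d}{\longrightarrow}\ \mathcal N(0,\mathbf V)\qquad(T\to\infty).$$ -/

import Mathlib

open MeasureTheory ProbabilityTheory Filter Topology
open scoped Matrix NNReal ENNReal

noncomputable section

/-- The `ℓ¹`-norm of a vector. -/
def vecNorm1 {d : ℕ} (x : Fin d → ℝ) : ℝ := ∑ i, |x i|

/-- The maximum column sum norm of a matrix. -/
def matNorm1 {d : ℕ} (M : Matrix (Fin d) (Fin d) ℝ) : ℝ := ⨆ q, ∑ p, |M p q|

/-- The two-sided linear process with time-varying coefficients
`X_{t,T} = μ(t/T) + ∑_{j ∈ ℤ} A_{t,T}(j) ε_{t-j}`.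
Here `A T t j` stands for `A_{t,T}(j)`. -/
def lsProcess {Ω : Type*} {d : ℕ} (ε : ℤ → Ω → Fin d → ℝ) (μ : ℝ → Fin d → ℝ)
    (A : ℕ → ℤ → ℤ → Matrix (Fin d) (Fin d) ℝ) (T : ℕ) (t : ℤ) (ω : Ω) : Fin d → ℝ :=
  μ ((t : ℝ) / (T : ℝ)) + ∑' j : ℤ, A T t j *ᵥ ε (t - j) ω

/-- The truncation `X_{t,T}^{(M)} = μ(t/T) + ∑_{|j| < M} A_{t,T}(j) ε_{t-j}`. -/
def lsProcessTrunc {Ω : Type*} {d : ℕ} (ε : ℤ → Ω → Fin d → ℝ) (μ : ℝ → Fin d → ℝ)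
    (A : ℕ → ℤ → ℤ → Matrix (Fin d) (Fin d) ℝ) (M : ℕ) (T : ℕ) (t : ℤ) (ω : Ω) : Fin d → ℝ :=
  μ ((t : ℝ) / (T : ℝ)) + ∑ j ∈ Finset.Ioo (-(M : ℤ)) (M : ℤ), A T t j *ᵥ ε (t - j) ω

/-- The companion process `X̃_t(u) = μ(u) + ∑_{j ∈ ℤ} A(u,j) ε_{t-j}`. -/
def companion {Ω : Type*} {d : ℕ} (ε : ℤ → Ω → Fin d → ℝ) (μ : ℝ → Fin d → ℝ)
    (Alim : ℝ → ℤ → Matrix (Fin d) (Fin d) ℝ) (u : ℝ) (t : ℤ) (ω : Ω) : Fin d → ℝ :=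
  μ u + ∑' j : ℤ, Alim u j *ᵥ ε (t - j) ω

/-- The truncation `X̃_t^{(M)}(u) = μ(u) + ∑_{|j| < M} A(u,j) ε_{t-j}`. -/
def companionTrunc {Ω : Type*} {d : ℕ} (ε : ℤ → Ω → Fin d → ℝ) (μ : ℝ → Fin d → ℝ)
    (Alim : ℝ → ℤ → Matrix (Fin d) (Fin d) ℝ) (M : ℕ) (u : ℝ) (t : ℤ) (ω : Ω) : Fin d → ℝ :=
  μ u + ∑ j ∈ Finset.Ioo (-(M : ℤ)) (M : ℤ), Alim u j *ᵥ ε (t - j) ω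

/-- The assumptions on the locally stationary linear process (innovations, coefficients with
once continuously differentiable limits, mean function), with decay constants `ϑ` and `B`. -/
structure LocallyStationaryLinear {Ω : Type*} [MeasurableSpace Ω] (P : Measure Ω) {d : ℕ}
    (ε : ℤ → Ω → Fin d → ℝ) (μ : ℝ → Fin d → ℝ)
    (A : ℕ → ℤ → ℤ → Matrix (Fin d) (Fin d) ℝ) (Alim : ℝ → ℤ → Matrix (Fin d) (Fin d) ℝ)
    (ϑ B : ℝ) : Prop where
  measurable_innov : ∀ t, Measurable (ε t)
  indep_innov : iIndepFun ε P
  identDistrib_innov : ∀ t, IdentDistrib (ε t) (ε 1) P P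
  integrable_innov : Integrable (ε 1) P
  centred_innov : ∫ ω, ε 1 ω ∂P = 0
  rate_mem : ϑ ∈ Set.Ioo (0 : ℝ) 1
  coeff_bound : ∀ (T : ℕ) (t : ℤ), 1 ≤ t → t ≤ T → ∀ j : ℤ, matNorm1 (A T t j) ≤ B * ϑ ^ j.natAbs
  contDiffOn_lim : ∀ (j : ℤ) (p q : Fin d),
    ContDiffOn ℝ 1 (fun u => Alim u j p q) (Set.Icc 0 1)
  lim_bound : ∀ (j : ℤ) (p q : Fin d), ∀ u ∈ Set.Icc (0 : ℝ) 1,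
    |Alim u j p q| ≤ B * ϑ ^ j.natAbs
  deriv_lim_bound : ∀ (j : ℤ) (p q : Fin d), ∀ u ∈ Set.Icc (0 : ℝ) 1,
    |derivWithin (fun v => Alim v j p q) (Set.Icc 0 1) u| ≤ B * ϑ ^ j.natAbs
  coeff_approx : ∀ (T : ℕ) (t : ℤ), 1 ≤ t → t ≤ T → ∀ j : ℤ,
    (T : ℝ) * matNorm1 (A T t j - Alim ((t : ℝ) / (T : ℝ)) j) ≤ B * ϑ ^ j.natAbs
  contDiffOn_mean : ∀ p : Fin d, ContDiffOn ℝ 1 (fun u => μ u p) (Set.Icc 0 1)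

/-- The number `d_T` of non-zero weights among `w_{1,T}, …, w_{T,T}`
(`w T t` stands for `w_{t,T}`). -/
def numNonzero (w : ℕ → ℤ → ℝ) (T : ℕ) : ℕ :=
  {t ∈ Finset.Icc (1 : ℤ) (T : ℤ) | w T t ≠ 0}.card

/-- The assumptions on the weights, with constant `Cw`. -/
structure AdmissibleWeights (w : ℕ → ℤ → ℝ) (Cw : ℝ) : Prop where
  nonneg : ∀ (T : ℕ) (t : ℤ), 1 ≤ t → t ≤ T → 0 ≤ w T t
  bound : ∀ (T : ℕ) (t : ℤ), 1 ≤ t → t ≤ T → w T t ≤ Cw / √(numNonzero w T : ℝ)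
  tendsto_numNonzero : Tendsto (numNonzero w) atTop atTop

/-- The assumptions on the function `f : S × ℝᵈ → ℝ`: uniform Lipschitz continuity in the second
argument (constant `CLip`), and uniform bounds (constant `K`) on moments of order `2 + δ`. -/
structure AdmissibleFunction {Ω : Type*} [MeasurableSpace Ω] (P : Measure Ω) {d : ℕ}
    (ε : ℤ → Ω → Fin d → ℝ) (μ : ℝ → Fin d → ℝ)
    (A : ℕ → ℤ → ℤ → Matrix (Fin d) (Fin d) ℝ) (Alim : ℝ → ℤ → Matrix (Fin d) (Fin d) ℝ)
    {S : Type*} (f : S → (Fin d → ℝ) → ℝ) (CLip δ : ℝ) (K : ℝ≥0) : Prop where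
  lipschitz : ∀ (s : S) (x y : Fin d → ℝ), |f s x - f s y| ≤ CLip * vecNorm1 (x - y)
  delta_mem : δ ∈ Set.Ioo (0 : ℝ) (1 / 2)
  moment : ∀ (T : ℕ) (t : ℤ), 1 ≤ t → t ≤ T → ∀ (s : S) (M : ℕ), 1 ≤ M →
    ∫⁻ ω, (‖f s (lsProcess ε μ A T t ω)‖ₑ ^ (2 + δ)
      + ‖f s (lsProcessTrunc ε μ A M T t ω)‖ₑ ^ (2 + δ)) ∂P ≤ K
  moment_companion : ∀ u ∈ Set.Icc (0 : ℝ) 1, ∀ (s : S) (M : ℕ), 1 ≤ M →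
    ∫⁻ ω, (‖f s (companion ε μ Alim u 0 ω)‖ₑ ^ (2 + δ)
      + ‖f s (companionTrunc ε μ Alim M u 0 ω)‖ₑ ^ (2 + δ)) ∂P ≤ K

/-- The weights extended to all `t ∈ ℤ` by `w_{t,T} = w_{1,T}` for `t < 1` and
`w_{t,T} = w_{T,T}` for `t > T`. -/
def extWeight (w : ℕ → ℤ → ℝ) (T : ℕ) (t : ℤ) : ℝ := w T (max 1 (min t (T : ℤ)))

/-- `∑_{t=1}^T w_{t,T} w_{t+h,T} Cov(f(s₁, X̃_0(t/T)), f(s₂, X̃_h(t/T)))`. -/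
def lagCov {Ω : Type*} [MeasurableSpace Ω] (P : Measure Ω) {d : ℕ}
    (ε : ℤ → Ω → Fin d → ℝ) (μ : ℝ → Fin d → ℝ) (Alim : ℝ → ℤ → Matrix (Fin d) (Fin d) ℝ)
    (w : ℕ → ℤ → ℝ) {S : Type*} (f : S → (Fin d → ℝ) → ℝ) (s₁ s₂ : S) (h : ℤ) (T : ℕ) : ℝ :=
  ∑ t ∈ Finset.Icc (1 : ℤ) (T : ℤ), w T t * extWeight w T (t + h) *
    cov[fun ω => f s₁ (companion ε μ Alim ((t : ℝ) / (T : ℝ)) 0 ω),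
      fun ω => f s₂ (companion ε μ Alim ((t : ℝ) / (T : ℝ)) h ω); P]

/-- The long-run covariance
`V(s₁,s₂) = ∑_{h ∈ ℤ} lim_{T → ∞} ∑_{t=1}^T w_{t,T} w_{t+h,T} Cov(f(s₁, X̃_0(t/T)), f(s₂, X̃_h(t/T)))`. -/
def longRunCov {Ω : Type*} [MeasurableSpace Ω] (P : Measure Ω) {d : ℕ}
    (ε : ℤ → Ω → Fin d → ℝ) (μ : ℝ → Fin d → ℝ) (Alim : ℝ → ℤ → Matrix (Fin d) (Fin d) ℝ)
    (w : ℕ → ℤ → ℝ) {S : Type*} (f : S → (Fin d → ℝ) → ℝ) (s₁ s₂ : S) : ℝ :=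
  ∑' h : ℤ, limUnder atTop (lagCov P ε μ Alim w f s₁ s₂ h)

/-- The weighted centred sum `∑_{t=1}^T w_{t,T} (f(s, X_{t,T}) - E f(s, X_{t,T}))`. -/
def weightedSum {Ω : Type*} [MeasurableSpace Ω] (P : Measure Ω) {d : ℕ}
    (ε : ℤ → Ω → Fin d → ℝ) (μ : ℝ → Fin d → ℝ)
    (A : ℕ → ℤ → ℤ → Matrix (Fin d) (Fin d) ℝ) (w : ℕ → ℤ → ℝ)
    {S : Type*} (f : S → (Fin d → ℝ) → ℝ) (s : S) (T : ℕ) (ω : Ω) : ℝ :=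
  ∑ t ∈ Finset.Icc (1 : ℤ) (T : ℤ), w T t *
    (f s (lsProcess ε μ A T t ω) - ∫ ω', f s (lsProcess ε μ A T t ω') ∂P)

end

/-! The array `f(s, X_{t,T})` has short memory, and everything rests on one quantitative form of
this, `LocalApprox`: each entry is within `C ρ^(2M)` in `L²` of a bounded variable that depends only
on the innovations with index at distance less than `M` from `t`, with constants uniform in `t` and
`T`. `localApprox_lsArray` proves it by truncating the linear filter and clamping the value. The
filter error is controlled only in `L¹`, since the innovations have just a first moment; the `2 + δ`
moments of `f` upgrade it to `L²`.

Local variables that are far apart are independent. Hence covariances decay geometrically in the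
lag, and the error of replacing a weighted sum by its local version is small uniformly in `T`
(`LocalApprox.abs_cov_sub_le`, `LocalApprox.l2_sum_sub_le`). For bounded local summands, Stein's
method applied to `φ(θ) = E exp(iθS)` gives `φ' ≈ -θ v φ` with `v = E S²`, so `φ(1)` is close to
`exp(-v/2)` (`norm_charFun_sub_gaussian_le`). Letting first `T` and then `M` grow,
`tendsto_charFun_weighted_sum` compares the weighted sum with the normal law of the same variance.
No lower bound on the variance is needed, so a singular limit matrix is allowed.

It remains to identify the limiting variances. The covariance of two weighted sums is a series over
lags. At each lag the array may be replaced by the stationary companion up to a vanishing error, and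
the geometric decay justifies dominated convergence (`tendsto_cov_weighted_sum`). Symmetry and
positivity of the limit matrix are inherited from covariances. The Cramér–Wold device works because
`LocalApprox` is stable under linear combinations, and Lévy's continuity theorem finishes. -/

noncomputable section

/-! ### Real-valued `L²` norm and covariance inequalities -/

section L2

variable {Ω : Type*} [MeasurableSpace Ω] {P : Measure Ω}

/-- The `L²`-norm of a real random variable. -/
def l2 (P : Measure Ω) (U : Ω → ℝ) : ℝ := √(∫ ω, U ω ^ 2 ∂P)

lemma l2_nonneg (U : Ω → ℝ) : 0 ≤ l2 P U := Real.sqrt_nonneg _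

lemma l2_sq (U : Ω → ℝ) : l2 P U ^ 2 = ∫ ω, U ω ^ 2 ∂P :=
  Real.sq_sqrt (integral_nonneg fun _ => sq_nonneg _)

lemma l2_le_of_integral_sq_le {U : Ω → ℝ} {c : ℝ} (hc : 0 ≤ c) (h : ∫ ω, U ω ^ 2 ∂P ≤ c ^ 2) :
    l2 P U ≤ c := Real.sqrt_le_iff.2 ⟨hc, h⟩

lemma integral_abs_mul_le_l2 {U V : Ω → ℝ} (hU : MemLp U 2 P) (hV : MemLp V 2 P) :
    ∫ ω, |U ω| * |V ω| ∂P ≤ l2 P U * l2 P V := by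
  have h := integral_mul_le_Lp_mul_Lq_of_nonneg (μ := P) (p := 2) (q := 2)
    Real.HolderConjugate.two_two (f := fun ω => |U ω|) (g := fun ω => |V ω|)
    (.of_forall fun _ => abs_nonneg _) (.of_forall fun _ => abs_nonneg _)
    (by rw [ENNReal.ofReal_ofNat]; exact hU.abs) (by rw [ENNReal.ofReal_ofNat]; exact hV.abs)
  simpa [l2, Real.sqrt_eq_rpow] using h

lemma abs_integral_mul_le_l2 {U V : Ω → ℝ} (hU : MemLp U 2 P) (hV : MemLp V 2 P) :
    |∫ ω, U ω * V ω ∂P| ≤ l2 P U * l2 P V := by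
  refine (abs_integral_le_integral_abs).trans ?_
  simp_rw [abs_mul]
  exact integral_abs_mul_le_l2 hU hV

lemma integral_abs_le_l2 [IsProbabilityMeasure P] {U : Ω → ℝ} (hU : MemLp U 2 P) :
    ∫ ω, |U ω| ∂P ≤ l2 P U := by
  have h := integral_abs_mul_le_l2 hU (memLp_const (μ := P) (1 : ℝ))
  simpa [l2] using h

lemma l2_add_le {U V : Ω → ℝ} (hU : MemLp U 2 P) (hV : MemLp V 2 P) :
    l2 P (fun ω => U ω + V ω) ≤ l2 P U + l2 P V := by
  refine l2_le_of_integral_sq_le (add_nonneg (l2_nonneg _) (l2_nonneg _)) ?_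
  have hUV : Integrable (fun ω => U ω * V ω) P := hU.integrable_mul hV
  have e : ∫ ω, (U ω + V ω) ^ 2 ∂P
      = ∫ ω, U ω ^ 2 ∂P + 2 * ∫ ω, U ω * V ω ∂P + ∫ ω, V ω ^ 2 ∂P := by
    rw [← integral_const_mul, ← integral_add hU.integrable_sq (hUV.const_mul 2),
      ← integral_add (hU.integrable_sq.fun_add (hUV.const_mul 2)) hV.integrable_sq]
    exact integral_congr_ae (.of_forall fun ω => by ring)
  have h1 := (le_abs_self _).trans (abs_integral_mul_le_l2 hU hV)
  rw [e, ← l2_sq, ← l2_sq]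
  nlinarith

lemma l2_neg (U : Ω → ℝ) : l2 P (fun ω => -U ω) = l2 P U := by simp [l2]

lemma l2_sub_le {U V : Ω → ℝ} (hU : MemLp U 2 P) (hV : MemLp V 2 P) :
    l2 P (fun ω => U ω - V ω) ≤ l2 P U + l2 P V := by
  have := l2_add_le hU hV.neg
  simp only [Pi.neg_apply, ← sub_eq_add_neg] at this
  exact this.trans_eq (by rw [← l2_neg V]; rfl)

lemma l2_sub_comm (U V : Ω → ℝ) :
    l2 P (fun ω => U ω - V ω) = l2 P (fun ω => V ω - U ω) := by
  simp only [l2]; congr 2; ext ω; ring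

lemma l2_const_mul (c : ℝ) (U : Ω → ℝ) : l2 P (fun ω => c * U ω) = |c| * l2 P U := by
  simp only [l2, mul_pow, integral_const_mul]
  rw [Real.sqrt_mul (sq_nonneg _), Real.sqrt_sq_eq_abs]

lemma abs_l2_sub_l2_le {U V : Ω → ℝ} (hU : MemLp U 2 P) (hV : MemLp V 2 P) :
    |l2 P U - l2 P V| ≤ l2 P (fun ω => U ω - V ω) := by
  have h1 := l2_add_le (hU.sub hV) hV
  have h2 := l2_add_le (hV.sub hU) hU
  simp only [Pi.sub_apply, sub_add_cancel] at h1 h2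
  have h3 : l2 P (U - V) = l2 P (fun ω => U ω - V ω) := rfl
  have h4 : l2 P (V - U) = l2 P (fun ω => U ω - V ω) := l2_sub_comm V U
  rw [h3] at h1
  rw [h4] at h2
  exact abs_le.2 ⟨by linarith [show l2 P (fun ω => V ω) = l2 P V from rfl],
    by linarith [show l2 P (fun ω => U ω) = l2 P U from rfl]⟩

lemma l2_sub_mean_le [IsProbabilityMeasure P] {U : Ω → ℝ} (hU : MemLp U 2 P) :
    l2 P (fun ω => U ω - ∫ ω', U ω' ∂P) ≤ l2 P U := by
  refine Real.sqrt_le_sqrt ?_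
  rw [← variance_eq_integral hU.aestronglyMeasurable.aemeasurable]
  exact variance_le_expectation_sq hU.aestronglyMeasurable

lemma memLp_sub_mean [IsProbabilityMeasure P] {U : Ω → ℝ} (hU : MemLp U 2 P) :
    MemLp (fun ω => U ω - ∫ ω', U ω' ∂P) 2 P := hU.sub (memLp_const _)

lemma abs_cov_le [IsProbabilityMeasure P] {U V : Ω → ℝ} (hU : MemLp U 2 P) (hV : MemLp V 2 P) :
    |cov[U, V; P]| ≤ l2 P U * l2 P V :=
  (abs_integral_mul_le_l2 (memLp_sub_mean hU) (memLp_sub_mean hV)).trans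
    (mul_le_mul (l2_sub_mean_le hU) (l2_sub_mean_le hV) (l2_nonneg _) (l2_nonneg _))

lemma abs_cov_sub_cov_le [IsProbabilityMeasure P] {U V U' V' : Ω → ℝ} (hU : MemLp U 2 P)
    (hV : MemLp V 2 P) (hU' : MemLp U' 2 P) (hV' : MemLp V' 2 P) :
    |cov[U, V; P] - cov[U', V'; P]| ≤
      l2 P (fun ω => U ω - U' ω) * l2 P V + l2 P U' * l2 P (fun ω => V ω - V' ω) := by
  have e : cov[U, V; P] - cov[U', V'; P]
      = cov[fun ω => U ω - U' ω, V; P] + cov[U', fun ω => V ω - V' ω; P] := by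
    rw [covariance_fun_sub_left hU hU' hV, covariance_fun_sub_right hU' hV hV']; ring
  rw [e]
  exact (abs_add_le _ _).trans
    (add_le_add (abs_cov_le (hU.sub hU') hV) (abs_cov_le hU' (hV.sub hV')))

end L2

/-! ### Locality and independence -/

section Locality

variable {Ω E : Type*} [mE : MeasurableSpace E]

/-- The `σ`-algebra generated by the innovations with index in `A`. -/
@[reducible]
def innovSigma (ε : ℤ → Ω → E) (A : Set ℤ) : MeasurableSpace Ω :=
  ⨆ j ∈ A, MeasurableSpace.comap (ε j) mE

lemma innovSigma_mono (ε : ℤ → Ω → E) {A A' : Set ℤ} (h : A ⊆ A') :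
    innovSigma ε A ≤ innovSigma ε A' := biSup_mono h

lemma innovSigma_le [mΩ : MeasurableSpace Ω] {ε : ℤ → Ω → E} (hε : ∀ t, Measurable (ε t)) (A : Set ℤ) :
    innovSigma ε A ≤ mΩ := iSup₂_le fun j _ => (hε j).comap_le

lemma measurable_innov (ε : ℤ → Ω → E) {A : Set ℤ} {j : ℤ} (hj : j ∈ A) :
    Measurable[innovSigma ε A] (ε j) :=
  (comap_measurable (ε j)).mono (le_biSup (fun j => MeasurableSpace.comap (ε j) mE) hj) le_rfl

/-- The integers at distance less than `M` from `t`. -/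
def nbhd (t : ℤ) (M : ℕ) : Set ℤ := {j | |j - t| < M}

/-- The `+ 1` reflects the strict inequality over the integers: a common index would force `|t - s|
≤ M + N - 2`. This is why `gap` can round up. -/
lemma disjoint_nbhd {t s : ℤ} {M N : ℕ} (h : (M + N : ℤ) ≤ |t - s| + 1) :
    Disjoint (nbhd t M) (nbhd s N) := by
  refine Set.disjoint_left.2 fun j (h1 : |j - t| < M) (h2 : |j - s| < N) => ?_
  rw [abs_lt] at h1 h2
  rcases abs_cases (t - s) with h3 | h3 <;> omega

lemma indepFun_of_disjoint [mΩ : MeasurableSpace Ω] {P : Measure Ω} {ε : ℤ → Ω → E} (hε : ∀ t, Measurable (ε t)) (hi : iIndepFun ε P)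
    {F G : Type*} [MeasurableSpace F] [MeasurableSpace G]
    {A A' : Set ℤ} (h : Disjoint A A') {U : Ω → F} {V : Ω → G}
    (hU : Measurable[innovSigma ε A] U) (hV : Measurable[innovSigma ε A'] V) :
    IndepFun U V P :=
  indep_of_indep_of_le_left (indep_of_indep_of_le_right
    (indep_iSup_of_disjoint (fun j => (hε j).comap_le) hi.iIndep h) hV.comap_le) hU.comap_le

end Locality

/-! ### Analytic ingredients of Stein's method -/

section SteinMethod

variable {Ω E : Type*} [mΩ : MeasurableSpace Ω] [mE : MeasurableSpace E] {P : Measure Ω}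

/-- For `|x| ≤ 1` this is the Taylor bound; otherwise the triangle inequality gives `2|x| ≤ 2x²`. -/
lemma norm_exp_mul_I_sub_one_sub_le (x : ℝ) :
    ‖Complex.exp (x * Complex.I) - 1 - x * Complex.I‖ ≤ 2 * x ^ 2 := by
  by_cases hx : |x| ≤ 1
  · have h := Complex.norm_exp_sub_one_sub_id_le (x := x * Complex.I) (by simpa using hx)
    simp only [norm_mul, Complex.norm_real, Complex.norm_I, mul_one, Real.norm_eq_abs, sq_abs] at h
    nlinarith [sq_nonneg x]
  · have h1 : ‖Complex.exp (x * Complex.I) - 1‖ ≤ |x| := by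
      rw [mul_comm]; exact Real.norm_exp_I_mul_ofReal_sub_one_le
    have h2 := norm_sub_le (Complex.exp (x * Complex.I) - 1) (x * Complex.I)
    simp only [norm_mul, Complex.norm_real, Complex.norm_I, mul_one, Real.norm_eq_abs] at h2
    nlinarith [sq_abs x]

/-- Integrating factor: `φ(θ) exp(θ²v/2)` has derivative at most `e · exp(v/2)` on `[0,1]`, and
multiplying back by `exp(-v/2)` at the end cancels the exponential exactly. -/
lemma norm_one_sub_gaussian_le_of_deriv {φ φ' : ℝ → ℂ} {v e : ℝ} (hv : 0 ≤ v) (h0 : φ 0 = 1)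
    (hφ : ∀ θ, HasDerivAt φ (φ' θ) θ)
    (he : ∀ θ ∈ Set.Icc (0 : ℝ) 1, ‖φ' θ + θ * v * φ θ‖ ≤ e) :
    ‖φ 1 - (Real.exp (-(v / 2)) : ℝ)‖ ≤ e := by
  have hd : ∀ θ : ℝ, HasDerivAt (fun θ : ℝ => φ θ * Complex.exp (((θ ^ 2 * (v / 2) : ℝ)) : ℂ))
      ((φ' θ + θ * v * φ θ) * Complex.exp ((θ ^ 2 * (v / 2) : ℝ) : ℂ)) θ := by
    intro θ
    have h1 : HasDerivAt (fun θ : ℝ => θ ^ 2 * (v / 2)) (θ * v) θ := by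
      have := (hasDerivAt_pow 2 θ).mul_const (v / 2)
      exact this.congr_deriv (by norm_num; ring)
    have h2 := (h1.ofReal_comp).cexp
    exact ((hφ θ).fun_mul h2).congr_deriv (by push_cast; ring)
  have h := norm_image_sub_le_of_norm_deriv_le_segment_01' (C := e * Real.exp (v / 2))
    (fun θ _ => (hd θ).hasDerivWithinAt) (fun θ hθ => by
      rw [norm_mul, Complex.norm_exp_ofReal]
      refine mul_le_mul (he θ ⟨hθ.1, hθ.2.le⟩) (Real.exp_le_exp.2 ?_) (Real.exp_nonneg _)
        ((norm_nonneg _).trans (he θ ⟨hθ.1, hθ.2.le⟩))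
      have : θ ^ 2 ≤ 1 := by nlinarith [hθ.1, hθ.2]
      nlinarith)
  have e1 : φ 1 - (Real.exp (-(v / 2)) : ℝ)
      = (φ 1 * Complex.exp (((1 : ℝ) ^ 2 * (v / 2) : ℝ) : ℂ)
        - φ 0 * Complex.exp (((0 : ℝ) ^ 2 * (v / 2) : ℝ) : ℂ)) * (Real.exp (-(v / 2)) : ℝ) := by
    rw [h0, sub_mul, mul_assoc, ← Complex.ofReal_exp, ← Complex.ofReal_mul, ← Real.exp_add]
    simp
  rw [e1, norm_mul, Complex.norm_real, Real.norm_eq_abs, Real.abs_exp]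
  refine (mul_le_mul_of_nonneg_right h (Real.exp_nonneg _)).trans_eq ?_
  rw [mul_assoc, ← Real.exp_add]; simp

end SteinMethod

/-! ### Normal approximation for bounded local variables -/

section SteinCLT

lemma measurable_sum_far {Ω E : Type*} [MeasurableSpace E] {ε : ℤ → Ω → E} {ξ : ℤ → Ω → ℝ} {M : ℕ}
    (hmeas : ∀ k, Measurable[innovSigma ε (nbhd k M)] (ξ k)) (I : Finset ℤ) {A : Set ℤ}
    (hA : ∀ k ∈ I, nbhd k M ⊆ A) :
    Measurable[innovSigma ε A] (fun ω => ∑ k ∈ I, ξ k ω) :=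
  Finset.measurable_fun_sum I fun k hk => (hmeas k).mono (innovSigma_mono ε (hA k hk)) le_rfl

variable {Ω E : Type*} [mΩ : MeasurableSpace Ω] [mE : MeasurableSpace E] {P : Measure Ω}

lemma card_filter_near_le (I : Finset ℤ) (k : ℤ) (N : ℕ) :
    ((I.filter fun l => |l - k| < N).card : ℝ) ≤ 2 * N := by
  have h : (I.filter fun l => |l - k| < N) ⊆ Finset.Ioo (k - N) (k + N) := fun l hl => by
    have := (Finset.mem_filter.1 hl).2
    rw [abs_lt] at this
    exact Finset.mem_Ioo.2 ⟨by omega, by omega⟩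
  have h2 := Finset.card_le_card h
  rw [Int.card_Ioo] at h2
  have h3 : (I.filter fun l => |l - k| < N).card ≤ 2 * N := by omega
  exact_mod_cast h3

lemma indepFun_sum_far {ε : ℤ → Ω → E} (hε : ∀ t, Measurable (ε t)) (hi : iIndepFun ε P)
    {ξ : ℤ → Ω → ℝ} {M : ℕ} (hmeas : ∀ k, Measurable[innovSigma ε (nbhd k M)] (ξ k))
    (I : Finset ℤ) (k : ℤ) :
    IndepFun (ξ k) (fun ω => ∑ l ∈ I.filter (fun l => ¬ |l - k| < (2 * M : ℕ)), ξ l ω) P := by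
  refine indepFun_of_disjoint hε hi (A := nbhd k M)
    (A' := ⋃ l ∈ I.filter (fun l => ¬ |l - k| < (2 * M : ℕ)), nbhd l M) ?_ (hmeas k)
    (measurable_sum_far hmeas _ fun l hl j hj => Set.mem_iUnion₂.2 ⟨l, hl, hj⟩)
  rw [Set.disjoint_iUnion₂_right]
  intro l hl
  have := (Finset.mem_filter.1 hl).2
  rw [abs_sub_comm] at this
  exact disjoint_nbhd (by push_cast at this; omega)

/-- A sum of bounded local variables has variance of the order of the number of summands. -/
lemma variance_sum_local_le [IsProbabilityMeasure P] {ε : ℤ → Ω → E}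
    (hε : ∀ t, Measurable (ε t)) (hi : iIndepFun ε P) {ξ : ℤ → Ω → ℝ} {M : ℕ}
    (hmeas : ∀ k, Measurable[innovSigma ε (nbhd k M)] (ξ k)) {β : ℝ} (hβ : 0 ≤ β)
    (hb : ∀ k ω, |ξ k ω| ≤ β) (I : Finset ℤ) :
    l2 P (fun ω => ∑ k ∈ I, ξ k ω - ∫ ω', ∑ k ∈ I, ξ k ω' ∂P) ≤ √(I.card * (4 * M) * β ^ 2) := by
  have hm : ∀ k, Measurable (ξ k) := fun k => (hmeas k).mono (innovSigma_le hε _) le_rfl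
  have hL : ∀ k, MemLp (ξ k) 2 P := fun k =>
    MemLp.of_bound (hm k).aestronglyMeasurable β (.of_forall (hb k))
  have hl : ∀ k, l2 P (ξ k) ≤ β := fun k => by
    refine l2_le_of_integral_sq_le hβ ?_
    have := integral_mono (hL k).integrable_sq (integrable_const (μ := P) (β ^ 2))
      (fun ω => sq_le_sq' (abs_le.1 (hb k ω)).1 (abs_le.1 (hb k ω)).2)
    simpa using this
  refine Real.sqrt_le_sqrt ?_
  have hmS : Measurable fun ω => ∑ k ∈ I, ξ k ω := Finset.measurable_fun_sum I fun k _ => hm k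
  rw [← variance_eq_integral hmS.aemeasurable, ← covariance_self hmS.aemeasurable,
    covariance_fun_sum_fun_sum' (fun k _ => hL k) (fun k _ => hL k)]
  have h1 : ∀ k ∈ I, ∑ l ∈ I, cov[ξ k, ξ l; P] ≤ (4 * M) * β ^ 2 := by
    intro k _
    -- Only the at most `4M` indices within distance `2M` of `k` contribute; beyond that the
    -- neighbourhoods are disjoint and the covariance vanishes.
    rw [← Finset.sum_filter_add_sum_filter_not I (fun l => |l - k| < (2 * M : ℕ))]
    have h2 : ∑ l ∈ I.filter (fun l => ¬ |l - k| < (2 * M : ℕ)), cov[ξ k, ξ l; P] = 0 := by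
      refine Finset.sum_eq_zero fun l hl => ?_
      have := (Finset.mem_filter.1 hl).2
      rw [abs_sub_comm] at this
      exact (indepFun_of_disjoint hε hi (disjoint_nbhd (by push_cast at this; omega))
        (hmeas k) (hmeas l)).covariance_eq_zero (hL k) (hL l)
    rw [h2, add_zero]
    refine (Finset.sum_le_card_nsmul _ _ (β ^ 2) fun l _ => ?_).trans ?_
    · refine (le_abs_self _).trans ((abs_cov_le (hL k) (hL l)).trans ?_)
      rw [sq]
      exact mul_le_mul (hl k) (hl l) (l2_nonneg _) hβ
    · rw [nsmul_eq_mul]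
      refine mul_le_mul_of_nonneg_right ?_ (sq_nonneg _)
      refine (card_filter_near_le I k (2 * M)).trans_eq ?_
      push_cast; ring
  refine (Finset.sum_le_card_nsmul _ _ _ h1).trans_eq ?_
  rw [nsmul_eq_mul]; ring

/-- Stein's method for bounded local variables: the characteristic function of the sum is close
to that of the normal distribution with the same variance. -/
theorem norm_charFun_sub_gaussian_le [IsProbabilityMeasure P] {ε : ℤ → Ω → E}
    (hε : ∀ t, Measurable (ε t)) (hi : iIndepFun ε P) {ξ : ℤ → Ω → ℝ} {M : ℕ}
    (hmeas : ∀ k, Measurable[innovSigma ε (nbhd k M)] (ξ k)) {β : ℝ} (hβ : 0 ≤ β)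
    (hb : ∀ k ω, |ξ k ω| ≤ β) (hc : ∀ k, ∫ ω, ξ k ω ∂P = 0) (I : Finset ℤ) :
    ‖∫ ω, Complex.exp ((∑ k ∈ I, ξ k ω : ℝ) * Complex.I) ∂P
        - (Real.exp (-((∫ ω, (∑ k ∈ I, ξ k ω) ^ 2 ∂P) / 2)) : ℝ)‖
      ≤ √(I.card * (12 * M) * (4 * M * β ^ 2) ^ 2) + I.card * (2 * β * (4 * M * β) ^ 2) := by
  classical
  set S : Ω → ℝ := fun ω => ∑ k ∈ I, ξ k ω with hS
  -- `η k` is the part of `S` near `k`, including `ξ k`, and `R k` is the rest, which is independent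
  -- of `ξ k`.
  set η : ℤ → Ω → ℝ := fun k ω => ∑ l ∈ I.filter (fun l => |l - k| < (2 * M : ℕ)), ξ l ω with hη
  set R : ℤ → Ω → ℝ := fun k ω => ∑ l ∈ I.filter (fun l => ¬ |l - k| < (2 * M : ℕ)), ξ l ω with hR
  have hSR : ∀ k ω, R k ω = S ω - η k ω := fun k ω => by
    rw [eq_sub_iff_add_eq, add_comm]
    exact Finset.sum_filter_add_sum_filter_not I _ _
  have hm : ∀ k, Measurable (ξ k) := fun k => (hmeas k).mono (innovSigma_le hε _) le_rfl
  have hmS : Measurable S := Finset.measurable_fun_sum I fun k _ => hm k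
  have hmη : ∀ k, Measurable (η k) := fun k => Finset.measurable_fun_sum _ fun k _ => hm k
  have hmR : ∀ k, Measurable (R k) := fun k => Finset.measurable_fun_sum _ fun k _ => hm k
  have hηb : ∀ k ω, |η k ω| ≤ 4 * M * β := fun k ω => by
    refine (Finset.abs_sum_le_sum_abs _ _).trans ((Finset.sum_le_card_nsmul _ _ β
      fun l _ => hb l ω).trans ?_)
    rw [nsmul_eq_mul]
    refine mul_le_mul_of_nonneg_right ((card_filter_near_le I k (2 * M)).trans_eq ?_) hβ
    push_cast; ring
  have hSb : ∀ ω, |S ω| ≤ I.card * β := fun ω => by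
    refine (Finset.abs_sum_le_sum_abs _ _).trans ((Finset.sum_le_card_nsmul _ _ β
      fun l _ => hb l ω).trans_eq (nsmul_eq_mul _ _))
  have hint : ∀ {U : Ω → ℝ} {c : ℝ}, Measurable U → (∀ ω, |U ω| ≤ c) → MemLp U 2 P :=
    fun hU hc => MemLp.of_bound hU.aestronglyMeasurable _ (.of_forall hc)
  have hexp : ∀ x : ℝ, ‖Complex.exp ((x : ℂ) * Complex.I)‖ = 1 :=
    fun x => Complex.norm_exp_ofReal_mul_I x
  have hintc : ∀ {U : Ω → ℝ} {V : Ω → ℝ} {c : ℝ}, Measurable U → (∀ ω, |U ω| ≤ c) →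
      Measurable V → Integrable (fun ω => (U ω : ℂ) * Complex.exp ((V ω : ℂ) * Complex.I)) P := by
    intro U V c hU hc hV
    refine Integrable.of_bound (by fun_prop) c (.of_forall fun ω => ?_)
    rw [norm_mul, hexp, mul_one, Complex.norm_real]
    exact hc ω
  set v : ℝ := ∫ ω, S ω ^ 2 ∂P with hv
  set Q : Ω → ℝ := fun ω => ∑ k ∈ I, ξ k ω * η k ω with hQ
  have hξη : ∀ k ω, |ξ k ω * η k ω| ≤ 4 * M * β ^ 2 := fun k ω => by
    rw [abs_mul]
    refine (mul_le_mul (hb k ω) (hηb k ω) (abs_nonneg _) hβ).trans_eq (by ring)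
  have hmQ : Measurable Q := Finset.measurable_fun_sum I fun k _ => (hm k).mul (hmη k)
  have hQb : ∀ ω, |Q ω| ≤ I.card * (4 * M * β ^ 2) := fun ω =>
    (Finset.abs_sum_le_sum_abs _ _).trans ((Finset.sum_le_card_nsmul _ _ _
      fun l _ => hξη l ω).trans_eq (nsmul_eq_mul _ _))
  have hEξR : ∀ k, ∫ ω, ξ k ω * R k ω ∂P = 0 := fun k => by
    rw [(indepFun_sum_far hε hi hmeas I k).integral_fun_mul_eq_mul_integral
      (hm k).aestronglyMeasurable (hmR k).aestronglyMeasurable, hc, zero_mul]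
  -- Write `S² = ∑ ξ_k (η_k + R_k)`; the terms with `R_k` have mean zero by independence and
  -- centring.
  have hvQ : v = ∫ ω, Q ω ∂P := by
    have e1 : ∀ ω, S ω ^ 2 = Q ω + ∑ k ∈ I, ξ k ω * R k ω := fun ω => by
      simp only [hSR, hQ, ← Finset.sum_add_distrib]
      rw [sq]
      conv_lhs => enter [1]; rw [hS]
      rw [Finset.sum_mul]
      exact Finset.sum_congr rfl fun k _ => by ring
    have hRi : ∀ k ∈ I, Integrable (fun ω => ξ k ω * R k ω) P := fun k _ => by
      have h1 : ∀ ω, |R k ω| ≤ I.card * β + 4 * M * β := fun ω => by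
        rw [hSR]; exact (abs_sub _ _).trans (add_le_add (hSb ω) (hηb k ω))
      exact (hint (hm k) (hb k)).integrable_mul (hint (hmR k) h1)
    rw [hv, integral_congr_ae (.of_forall e1), integral_add
      ((hint hmQ hQb).integrable one_le_two) (integrable_finsetSum _ hRi),
      integral_finsetSum _ hRi, Finset.sum_eq_zero fun k _ => hEξR k, add_zero]
  have hE1 : ∀ (k : ℤ) (θ : ℝ),
      ∫ ω, (ξ k ω : ℂ) * Complex.exp ((θ * R k ω : ℝ) * Complex.I) ∂P = 0 := fun k θ => by
    have h1 := (indepFun_sum_far hε hi hmeas I k).comp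
      (φ := fun x : ℝ => (x : ℂ)) (ψ := fun x : ℝ => Complex.exp ((θ * x : ℝ) * Complex.I))
      (by fun_prop) (by fun_prop)
    have h2 := h1.integral_fun_mul_eq_mul_integral (by have := hm k; fun_prop)
      (by have := hmR k; fun_prop)
    refine h2.trans ?_
    simp only [Function.comp_def]
    rw [integral_complex_ofReal, hc]
    simp
  set φ : ℝ → ℂ := fun θ => ∫ ω, Complex.exp ((θ * S ω : ℝ) * Complex.I) ∂P with hφ
  set φ' : ℝ → ℂ := fun θ => ∫ ω, (S ω * Complex.I) * Complex.exp ((θ * S ω : ℝ) * Complex.I) ∂P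
    with hφ'
  have hd : ∀ θ, HasDerivAt φ (φ' θ) θ := fun θ => by
    refine (hasDerivAt_integral_of_dominated_loc_of_deriv_le (μ := P)
      (F := fun (θ : ℝ) ω => Complex.exp ((θ * S ω : ℝ) * Complex.I))
      (F' := fun (θ : ℝ) ω => (S ω * Complex.I) * Complex.exp ((θ * S ω : ℝ) * Complex.I))
      (bound := fun _ => I.card * β) (s := Set.univ) univ_mem
      (.of_forall fun θ => by fun_prop) ?_ (by fun_prop)
      (.of_forall fun ω θ _ => ?_) (integrable_const _) (.of_forall fun ω θ _ => ?_)).2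
    · exact Integrable.of_bound (by fun_prop) 1 (.of_forall fun ω => (hexp _).le)
    · rw [norm_mul, hexp, mul_one, norm_mul, Complex.norm_I, mul_one, Complex.norm_real]
      exact hSb ω
    · have h1 : HasDerivAt (fun θ : ℝ => θ * S ω) (S ω) θ := by
        simpa using (hasDerivAt_id θ).mul_const (S ω)
      exact ((h1.ofReal_comp.mul_const Complex.I).cexp).congr_deriv (by ring)
  -- Stein's identity at one site: `exp(iθS) = exp(iθR_k) exp(iθη_k)`, and expanding the near factor
  -- to first order leaves a remainder quadratic in `η_k`.
  have hk : ∀ (k : ℤ) (θ : ℝ), θ ∈ Set.Icc (0 : ℝ) 1 →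
      ‖Complex.I * ∫ ω, (ξ k ω : ℂ) * Complex.exp ((θ * S ω : ℝ) * Complex.I) ∂P
        + θ * ∫ ω, ((ξ k ω * η k ω : ℝ) : ℂ) * Complex.exp ((θ * S ω : ℝ) * Complex.I) ∂P‖
      ≤ 2 * β * (4 * M * β) ^ 2 := by
    intro k θ hθ
    have e : Complex.I * ∫ ω, (ξ k ω : ℂ) * Complex.exp ((θ * S ω : ℝ) * Complex.I) ∂P
        + θ * ∫ ω, ((ξ k ω * η k ω : ℝ) : ℂ) * Complex.exp ((θ * S ω : ℝ) * Complex.I) ∂P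
        = ∫ ω, -(Complex.I * ξ k ω * Complex.exp ((θ * S ω : ℝ) * Complex.I) *
          (Complex.exp ((-(θ * η k ω) : ℝ) * Complex.I) - 1
            - (-(θ * η k ω) : ℝ) * Complex.I)) ∂P := by
      -- The zero being subtracted is `i E[ξ_k exp(iθR_k)]`, which turns the left side into a
      -- second-order Taylor remainder.
      rw [← sub_zero (_ + _), ← mul_zero Complex.I, ← hE1 k θ, ← integral_const_mul,
        ← integral_const_mul, ← integral_const_mul, ← integral_add, ← integral_sub]
      · refine integral_congr_ae (.of_forall fun ω => ?_)
        have h1 : Complex.exp ((θ * R k ω : ℝ) * Complex.I)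
            = Complex.exp ((θ * S ω : ℝ) * Complex.I)
              * Complex.exp ((-(θ * η k ω) : ℝ) * Complex.I) := by
          rw [← Complex.exp_add, hSR]; congr 1; push_cast; ring
        simp only [h1]
        push_cast
        linear_combination ((θ : ℂ) * ξ k ω * η k ω *
          Complex.exp (θ * S ω * Complex.I)) * Complex.I_sq
      · exact ((hintc (hm k) (hb k) (hmS.const_mul θ)).const_mul _).add
          ((hintc ((hm k).mul (hmη k)) (hξη k) (hmS.const_mul θ)).const_mul _)
      · exact (hintc (hm k) (hb k) ((hmR k).const_mul θ)).const_mul _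
      · exact (hintc (hm k) (hb k) (hmS.const_mul θ)).const_mul _
      · exact (hintc ((hm k).mul (hmη k)) (hξη k) (hmS.const_mul θ)).const_mul _
    rw [e]
    refine (norm_integral_le_of_norm_le_const (.of_forall fun ω => ?_)).trans_eq
      (by rw [probReal_univ, mul_one])
    rw [norm_neg, norm_mul, norm_mul, norm_mul, Complex.norm_I, one_mul, hexp, mul_one,
      Complex.norm_real, Real.norm_eq_abs]
    refine (mul_le_mul (hb k ω) (norm_exp_mul_I_sub_one_sub_le _) (norm_nonneg _) hβ).trans ?_
    have h1 : (θ * η k ω) ^ 2 ≤ (4 * M * β) ^ 2 := by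
      refine sq_le_sq' ?_ ?_ <;>
      · have h2 : |θ * η k ω| ≤ 4 * M * β := by
          rw [abs_mul, abs_of_nonneg hθ.1]
          exact (mul_le_of_le_one_left (abs_nonneg _) hθ.2).trans (hηb k ω)
        have := abs_le.1 h2
        linarith [this.1, this.2]
    rw [neg_sq]
    nlinarith
  -- The products `ξ_k η_k` are themselves local, of radius `3M`, so the variance bound applies
  -- again with `4 · 3M = 12M`; this replaces `Q` by its mean `v`.
  have hQl : l2 P (fun ω => Q ω - ∫ ω', Q ω' ∂P) ≤ √(I.card * (12 * M) * (4 * M * β ^ 2) ^ 2) := by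
    have hmQ' : ∀ k, Measurable[innovSigma ε (nbhd k (3 * M))] (fun ω => ξ k ω * η k ω) := by
      intro k
      refine Measurable.mul ((hmeas k).mono (innovSigma_mono ε ?_) le_rfl)
        (measurable_sum_far hmeas _ fun l hl => ?_)
      · intro j (hj : |j - k| < M)
        change |j - k| < (3 * M : ℕ)
        push_cast; omega
      · intro j (hj : |j - l| < M)
        have hl2 := (Finset.mem_filter.1 hl).2
        change |j - k| < (3 * M : ℕ)
        rw [abs_lt] at *
        push_cast at *; constructor <;> omega
    refine (variance_sum_local_le hε hi hmQ' (by positivity) hξη I).trans_eq ?_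
    push_cast; congr 3; ring
  have hmain : ∀ θ ∈ Set.Icc (0 : ℝ) 1, ‖φ' θ + θ * v * φ θ‖ ≤
      √(I.card * (12 * M) * (4 * M * β ^ 2) ^ 2) + I.card * (2 * β * (4 * M * β) ^ 2) := by
    intro θ hθ
    have e1 : φ' θ = ∑ k ∈ I, Complex.I * ∫ ω, (ξ k ω : ℂ) *
        Complex.exp ((θ * S ω : ℝ) * Complex.I) ∂P := by
      rw [hφ', ← Finset.mul_sum, ← integral_finsetSum _ fun k _ =>
        hintc (hm k) (hb k) (hmS.const_mul θ), ← integral_const_mul]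
      refine integral_congr_ae (.of_forall fun ω => ?_)
      simp only [← Finset.sum_mul, hS]
      push_cast; ring
    have e2 : ∫ ω, (Q ω : ℂ) * Complex.exp ((θ * S ω : ℝ) * Complex.I) ∂P
        = ∑ k ∈ I, ∫ ω, ((ξ k ω * η k ω : ℝ) : ℂ) *
          Complex.exp ((θ * S ω : ℝ) * Complex.I) ∂P := by
      rw [← integral_finsetSum _ fun k _ =>
        hintc (U := fun ω => ξ k ω * η k ω) ((hm k).mul (hmη k)) (hξη k) (hmS.const_mul θ)]
      refine integral_congr_ae (.of_forall fun ω => ?_)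
      simp only [← Finset.sum_mul, hQ]
      push_cast; ring
    have e3 : ∫ ω, ((Q ω - ∫ ω', Q ω' ∂P : ℝ) : ℂ) *
        Complex.exp ((θ * S ω : ℝ) * Complex.I) ∂P
        = ∫ ω, (Q ω : ℂ) * Complex.exp ((θ * S ω : ℝ) * Complex.I) ∂P - v * φ θ := by
      rw [hvQ, hφ, ← integral_const_mul, ← integral_sub (hintc hmQ hQb (hmS.const_mul θ))
        (Integrable.of_bound (by fun_prop) |∫ ω', Q ω' ∂P| (.of_forall fun ω => by
          rw [norm_mul, hexp, mul_one, Complex.norm_real, Real.norm_eq_abs]))]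
      refine integral_congr_ae (.of_forall fun ω => ?_)
      push_cast; ring
    -- Two error sources: the fluctuation of `Q` around `v`, and the single-site Taylor remainders.
    have e4 : φ' θ + θ * v * φ θ
        = -(θ * ∫ ω, ((Q ω - ∫ ω', Q ω' ∂P : ℝ) : ℂ) *
            Complex.exp ((θ * S ω : ℝ) * Complex.I) ∂P)
          + ∑ k ∈ I, (Complex.I * ∫ ω, (ξ k ω : ℂ) *
            Complex.exp ((θ * S ω : ℝ) * Complex.I) ∂P
          + θ * ∫ ω, ((ξ k ω * η k ω : ℝ) : ℂ) *
            Complex.exp ((θ * S ω : ℝ) * Complex.I) ∂P) := by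
      rw [Finset.sum_add_distrib, ← e1, ← Finset.mul_sum, ← e2, e3]; ring
    rw [e4]
    refine (norm_add_le _ _).trans (add_le_add ?_ ?_)
    · rw [norm_neg, norm_mul, Complex.norm_real, Real.norm_eq_abs, abs_of_nonneg hθ.1]
      refine (mul_le_of_le_one_left (norm_nonneg _) hθ.2).trans ?_
      refine (norm_integral_le_integral_norm _).trans ?_
      simp only [norm_mul, hexp, mul_one, Complex.norm_real, Real.norm_eq_abs]
      exact (integral_abs_le_l2 (memLp_sub_mean (hint hmQ hQb))).trans hQl
    · refine (norm_sum_le _ _).trans ((Finset.sum_le_card_nsmul _ _ _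
        fun k _ => hk k θ hθ).trans_eq (nsmul_eq_mul _ _))
  have hfin := norm_one_sub_gaussian_le_of_deriv (integral_nonneg fun _ => sq_nonneg _)
    (by simp [hφ]) hd hmain
  simpa only [hφ, one_mul] using hfin

end SteinCLT

/-! ### Summable decay over lags -/

section Decay

lemma summable_pow_natAbs {r : ℝ} (h0 : 0 ≤ r) (h1 : r < 1) :
    Summable fun j : ℤ => r ^ j.natAbs :=
  Summable.of_nat_of_neg (by simpa using summable_geometric_of_lt_one h0 h1)
    (by simpa using summable_geometric_of_lt_one h0 h1)

/-- Variables of locality radius `gap h` at distance `|h|` are independent. -/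
def gap (h : ℤ) : ℕ := (h.natAbs + 1) / 2

lemma gap_neg (h : ℤ) : gap (-h) = gap h := by simp [gap]

/-- Since `2 * gap h ≥ |h|`, the series is dominated by a geometric one with ratio `√ρ`. -/
lemma summable_pow_gap {ρ : ℝ} (h0 : 0 ≤ ρ) (h1 : ρ < 1) : Summable fun h : ℤ => ρ ^ gap h := by
  refine Summable.of_nonneg_of_le (fun h => pow_nonneg h0 _) (fun h => ?_)
    (summable_pow_natAbs (Real.sqrt_nonneg ρ)
      ((Real.sqrt_lt_sqrt h0 h1).trans_eq Real.sqrt_one))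
  rw [← Real.sq_sqrt h0, ← pow_mul, Real.sq_sqrt h0]
  refine pow_le_pow_of_le_one (Real.sqrt_nonneg _) (Real.sqrt_le_one.2 h1.le) ?_
  unfold gap; omega

/-- Schur test: bound `2|w_t||w_s|` by `w_t² + w_s²` and sum the symmetric kernel along rows and
columns. -/
lemma sum_sum_mul_le {κ : ℤ → ℝ} (hκ0 : ∀ h, 0 ≤ κ h) (hκs : ∀ h, κ (-h) = κ h)
    (hκ : Summable κ) (I : Finset ℤ) (w : ℤ → ℝ) :
    ∑ t ∈ I, ∑ s ∈ I, |w t| * |w s| * κ (s - t) ≤ (∑' h, κ h) * ∑ t ∈ I, w t ^ 2 := by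
  have h1 : ∀ t, ∑ s ∈ I, κ (s - t) ≤ ∑' h, κ h := fun t => by
    rw [← (Equiv.subRight t).tsum_eq κ]
    exact Summable.sum_le_tsum (f := fun s => κ (s - t)) I (fun s _ => hκ0 _)
      ((Equiv.subRight t).summable_iff.2 hκ)
  have h2 : ∑ t ∈ I, ∑ s ∈ I, w t ^ 2 * κ (s - t) ≤ (∑' h, κ h) * ∑ t ∈ I, w t ^ 2 := by
    rw [Finset.mul_sum]
    refine Finset.sum_le_sum fun t _ => ?_
    rw [← Finset.mul_sum, mul_comm]
    exact mul_le_mul_of_nonneg_right (h1 t) (sq_nonneg _)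
  have h3 : ∑ t ∈ I, ∑ s ∈ I, w s ^ 2 * κ (s - t) ≤ (∑' h, κ h) * ∑ t ∈ I, w t ^ 2 := by
    rw [Finset.sum_comm]
    refine (Finset.sum_le_sum fun s _ => Finset.sum_le_sum fun t _ => ?_).trans h2
    rw [← hκs, neg_sub]
  have h4 : ∑ t ∈ I, ∑ s ∈ I, 2 * (|w t| * |w s| * κ (s - t))
      ≤ ∑ t ∈ I, ∑ s ∈ I, (w t ^ 2 * κ (s - t) + w s ^ 2 * κ (s - t)) := by
    refine Finset.sum_le_sum fun t _ => Finset.sum_le_sum fun s _ => ?_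
    have := mul_nonneg (sq_nonneg (|w t| - |w s|)) (hκ0 (s - t))
    rw [← sq_abs (w t), ← sq_abs (w s)]
    linarith
  simp only [Finset.sum_add_distrib, ← Finset.mul_sum] at h2 h3 h4
  linarith

end Decay

/-! ### Arrays approximable by bounded local variables -/

section LocalApprox

variable {Ω E : Type*} [mΩ : MeasurableSpace Ω] [mE : MeasurableSpace E] {P : Measure Ω}

/-- A family `Y` of square integrable variables which is approximated in `L²` at geometric rate by
bounded variables `Y' M` depending only on the innovations at distance less than `M`. -/
structure LocalApprox (P : Measure Ω) (ε : ℤ → Ω → E) (Y : ℤ → Ω → ℝ) (Y' : ℕ → ℤ → Ω → ℝ)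
    (b : ℕ → ℝ) (C ρ : ℝ) : Prop where
  memLp : ∀ t, MemLp (Y t) 2 P
  meas : ∀ M t, Measurable[innovSigma ε (nbhd t M)] (Y' M t)
  bdd : ∀ M t ω, |Y' M t ω| ≤ b M
  approx : ∀ M t, l2 P (fun ω => Y t ω - Y' M t ω) ≤ C * ρ ^ (2 * M)
  zero : ∀ t ω, Y' 0 t ω = 0

variable {ε : ℤ → Ω → E} {Y Z : ℤ → Ω → ℝ} {Y' Z' : ℕ → ℤ → Ω → ℝ} {b b' : ℕ → ℝ} {C ρ : ℝ}

namespace LocalApprox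

lemma l2_le (h : LocalApprox P ε Y Y' b C ρ) (t : ℤ) : l2 P (Y t) ≤ C := by
  simpa [h.zero] using h.approx 0 t

lemma const_nonneg (h : LocalApprox P ε Y Y' b C ρ) : 0 ≤ C := (l2_nonneg _).trans (h.l2_le 0)

lemma memLp' [IsProbabilityMeasure P] (hε : ∀ t, Measurable (ε t))
    (h : LocalApprox P ε Y Y' b C ρ) (M : ℕ) (t : ℤ) : MemLp (Y' M t) 2 P :=
  MemLp.of_bound (((h.meas M t).mono (innovSigma_le hε _) le_rfl).aestronglyMeasurable) (b M)
    (.of_forall (h.bdd M t))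

lemma approx_le (h : LocalApprox P ε Y Y' b C ρ) (hρ : ρ ∈ Set.Ioo (0 : ℝ) 1) (M : ℕ) (t : ℤ) :
    l2 P (fun ω => Y t ω - Y' M t ω) ≤ C :=
  (h.approx M t).trans (mul_le_of_le_one_right h.const_nonneg (pow_le_one₀ hρ.1.le hρ.2.le))

/-- Let `N = gap (s - t)`. If `N ≤ M`, Cauchy–Schwarz suffices. If `N > M`, pass to radius `N`: the
local differences between radii `N` and `M` at `t` and `s` are independent, and each remaining term
contains an error `C ρ^(2N)`, against `C` and `2C`, whence the `3`. The exponent `2M` in `approx`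
pays for both factors `ρ^M` and `ρ^gap`. -/
lemma abs_cov_sub_le [IsProbabilityMeasure P] (hε : ∀ t, Measurable (ε t)) (hi : iIndepFun ε P)
    (hρ : ρ ∈ Set.Ioo (0 : ℝ) 1) (hY : LocalApprox P ε Y Y' b C ρ)
    (hZ : LocalApprox P ε Z Z' b' C ρ) (M : ℕ) (t s : ℤ) :
    |cov[fun ω => Y t ω - Y' M t ω, fun ω => Z s ω - Z' M s ω; P]|
      ≤ 3 * C ^ 2 * ρ ^ M * ρ ^ gap (s - t) := by
  have hC := hY.const_nonneg
  have hYM := hY.memLp' hε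
  have hZM := hZ.memLp' hε
  set N := gap (s - t) with hN
  have hp : ∀ k, 0 ≤ ρ ^ k := fun k => pow_nonneg hρ.1.le k
  rcases le_or_gt N M with hNM | hNM
  · refine (abs_cov_le ((hY.memLp t).sub (hYM M t)) ((hZ.memLp s).sub (hZM M s))).trans ?_
    refine (mul_le_mul (hY.approx M t) (hZ.approx_le hρ M s) (l2_nonneg _)
      (mul_nonneg hC (hp _))).trans ?_
    have h1 : ρ ^ (2 * M) ≤ ρ ^ M * ρ ^ N := by
      rw [← pow_add]; exact pow_le_pow_of_le_one hρ.1.le hρ.2.le (by omega)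
    have := mul_le_mul_of_nonneg_left h1 (sq_nonneg C)
    nlinarith only [this, mul_nonneg (sq_nonneg C) (mul_nonneg (hp M) (hp N))]
  · have hA : MemLp (fun ω => Y t ω - Y' N t ω) 2 P := (hY.memLp t).sub (hYM N t)
    have hB : MemLp (fun ω => Y' N t ω - Y' M t ω) 2 P := (hYM N t).sub (hYM M t)
    have hA' : MemLp (fun ω => Z s ω - Z' N s ω) 2 P := (hZ.memLp s).sub (hZM N s)
    have hB' : MemLp (fun ω => Z' N s ω - Z' M s ω) 2 P := (hZM N s).sub (hZM M s)
    have hD' : MemLp (fun ω => Z s ω - Z' M s ω) 2 P := (hZ.memLp s).sub (hZM M s)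
    have hzero : cov[fun ω => Y' N t ω - Y' M t ω, fun ω => Z' N s ω - Z' M s ω; P] = 0 := by
      have hsub : ∀ u : ℤ, nbhd u M ⊆ nbhd u N := fun u j (hj : |j - u| < M) => by
        change |j - u| < N
        omega
      refine (indepFun_of_disjoint hε hi (A := nbhd t N) (A' := nbhd s N) (disjoint_nbhd ?_)
        ((hY.meas N t).sub ((hY.meas M t).mono (innovSigma_mono ε (hsub t)) le_rfl))
        ((hZ.meas N s).sub ((hZ.meas M s).mono (innovSigma_mono ε (hsub s)) le_rfl))
        ).covariance_eq_zero hB hB'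
      rw [hN, gap, abs_sub_comm, Int.abs_eq_natAbs]
      omega
    have e : cov[fun ω => Y t ω - Y' M t ω, fun ω => Z s ω - Z' M s ω; P]
        = cov[fun ω => Y t ω - Y' N t ω, fun ω => Z s ω - Z' M s ω; P]
          + cov[fun ω => Y' N t ω - Y' M t ω, fun ω => Z s ω - Z' N s ω; P] := by
      have e1 : (fun ω => Y t ω - Y' M t ω)
          = (fun ω => Y t ω - Y' N t ω) + fun ω => Y' N t ω - Y' M t ω := by
        ext ω; simp
      have e2 : (fun ω => Z s ω - Z' M s ω)
          = (fun ω => Z s ω - Z' N s ω) + fun ω => Z' N s ω - Z' M s ω := by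
        ext ω; simp
      rw [e1, covariance_add_left hA hB hD', e2,
        covariance_add_right hB hA' hB', hzero, add_zero]
    rw [e]
    have hBl : l2 P (fun ω => Y' N t ω - Y' M t ω) ≤ 2 * C := by
      have h1 := l2_sub_le ((hY.memLp t).sub (hYM M t)) hA
      have h2 : (fun ω => (Y t - Y' M t) ω - (Y t ω - Y' N t ω))
          = fun ω => Y' N t ω - Y' M t ω := by ext ω; simp
      rw [h2] at h1
      refine h1.trans ?_
      have := hY.approx_le hρ M t
      have h3 := hY.approx_le hρ N t
      have h4 : l2 P (Y t - Y' M t) ≤ C := this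
      linarith
    have h1 := (abs_cov_le hA hD').trans
      (mul_le_mul (hY.approx N t) (hZ.approx_le hρ M s) (l2_nonneg _) (mul_nonneg hC (hp _)))
    have h2 := (abs_cov_le hB hA').trans
      (mul_le_mul hBl (hZ.approx N s) (l2_nonneg _) (by positivity))
    refine (abs_add_le _ _).trans ((add_le_add h1 h2).trans ?_)
    have h3 : ρ ^ (2 * N) ≤ ρ ^ M * ρ ^ N := by
      rw [← pow_add]; exact pow_le_pow_of_le_one hρ.1.le hρ.2.le (by omega)
    have := mul_le_mul_of_nonneg_left h3 (sq_nonneg C)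
    nlinarith

lemma abs_cov_le [IsProbabilityMeasure P] (hε : ∀ t, Measurable (ε t)) (hi : iIndepFun ε P)
    (hρ : ρ ∈ Set.Ioo (0 : ℝ) 1) (hY : LocalApprox P ε Y Y' b C ρ)
    (hZ : LocalApprox P ε Z Z' b' C ρ) (t s : ℤ) :
    |cov[Y t, Z s; P]| ≤ 3 * C ^ 2 * ρ ^ gap (s - t) := by
  -- At radius `0` the approximants vanish, so the differences are the variables themselves.
  simpa [hY.zero, hZ.zero] using abs_cov_sub_le hε hi hρ hY hZ 0 t s

/-- The squared norm is a variance, hence a double sum of the covariances just bounded, to which the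
Schur test applies. The bound sees the index set only through `W`. -/
lemma l2_sum_sub_le [IsProbabilityMeasure P] (hε : ∀ t, Measurable (ε t)) (hi : iIndepFun ε P)
    (hρ : ρ ∈ Set.Ioo (0 : ℝ) 1) (hY : LocalApprox P ε Y Y' b C ρ) (I : Finset ℤ) (w : ℤ → ℝ)
    {W : ℝ} (hW : ∑ t ∈ I, w t ^ 2 ≤ W) (M : ℕ) :
    l2 P (fun ω => ∑ t ∈ I, w t * (Y t ω - ∫ ω', Y t ω' ∂P)
        - ∑ t ∈ I, w t * (Y' M t ω - ∫ ω', Y' M t ω' ∂P))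
      ≤ √(3 * C ^ 2 * (∑' h, ρ ^ gap h) * W * ρ ^ M) := by
  have hYM := hY.memLp' hε
  have hD : ∀ t, MemLp (fun ω => w t * (Y t ω - Y' M t ω)) 2 P := fun t =>
    ((hY.memLp t).sub (hYM M t)).const_mul (w t)
  have hDS : MemLp (fun ω => ∑ t ∈ I, w t * (Y t ω - Y' M t ω)) 2 P :=
    memLp_finsetSum I fun t _ => hD t
  have e : ∀ ω, ∑ t ∈ I, w t * (Y t ω - ∫ ω', Y t ω' ∂P)
        - ∑ t ∈ I, w t * (Y' M t ω - ∫ ω', Y' M t ω' ∂P)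
      = ∑ t ∈ I, w t * (Y t ω - Y' M t ω)
        - ∫ ω', ∑ t ∈ I, w t * (Y t ω' - Y' M t ω') ∂P := fun ω => by
    rw [integral_finsetSum _ fun t _ => (hD t).integrable one_le_two, ← Finset.sum_sub_distrib,
      ← Finset.sum_sub_distrib]
    refine Finset.sum_congr rfl fun t _ => ?_
    rw [integral_const_mul, integral_sub ((hY.memLp t).integrable one_le_two)
      ((hYM M t).integrable one_le_two)]
    ring
  simp only [e]
  refine Real.sqrt_le_sqrt ?_
  have hae := hDS.aestronglyMeasurable.aemeasurable
  rw [← variance_eq_integral hae, ← covariance_self hae,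
    covariance_fun_sum_fun_sum' (fun t _ => hD t) (fun t _ => hD t)]
  have h1 : ∑ t ∈ I, ∑ s ∈ I, cov[fun ω => w t * (Y t ω - Y' M t ω),
      fun ω => w s * (Y s ω - Y' M s ω); P]
      ≤ ∑ t ∈ I, ∑ s ∈ I, 3 * C ^ 2 * ρ ^ M * (|w t| * |w s| * ρ ^ gap (s - t)) := by
    refine Finset.sum_le_sum fun t _ => Finset.sum_le_sum fun s _ => ?_
    rw [covariance_const_mul_left, covariance_const_mul_right]
    refine (le_abs_self _).trans ?_
    rw [abs_mul, abs_mul]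
    have := mul_le_mul_of_nonneg_left (abs_cov_sub_le hε hi hρ hY hY M t s)
      (mul_nonneg (abs_nonneg (w t)) (abs_nonneg (w s)))
    linarith
  refine h1.trans ?_
  simp only [← Finset.mul_sum]
  have h2 := sum_sum_mul_le (κ := fun h => ρ ^ gap h) (fun h => pow_nonneg hρ.1.le _)
    (fun h => by rw [gap_neg]) (summable_pow_gap hρ.1.le hρ.2) I w
  have h3 := h2.trans (mul_le_mul_of_nonneg_left hW
    (tsum_nonneg fun h => pow_nonneg hρ.1.le (gap h)))
  have h4 := mul_le_mul_of_nonneg_left h3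
    (mul_nonneg (mul_nonneg (by norm_num : (0 : ℝ) ≤ 3) (sq_nonneg C)) (pow_nonneg hρ.1.le M))
  linarith

/-- Together with `const_mul` and `finset_sum`, this makes the class stable under the linear
combinations of the Cramér–Wold device. -/
lemma add (hY : LocalApprox P ε Y Y' b C ρ) {C' : ℝ} (hZ : LocalApprox P ε Z Z' b' C' ρ)
    [IsProbabilityMeasure P] (hε : ∀ t, Measurable (ε t)) :
    LocalApprox P ε (fun t ω => Y t ω + Z t ω) (fun M t ω => Y' M t ω + Z' M t ω)
      (fun M => b M + b' M) (C + C') ρ where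
  memLp t := (hY.memLp t).add (hZ.memLp t)
  meas M t := (hY.meas M t).add (hZ.meas M t)
  bdd M t ω := (abs_add_le _ _).trans (add_le_add (hY.bdd M t ω) (hZ.bdd M t ω))
  approx M t := by
    have := l2_add_le ((hY.memLp t).sub (hY.memLp' hε M t)) ((hZ.memLp t).sub (hZ.memLp' hε M t))
    refine le_trans (le_of_eq ?_) (this.trans ((add_le_add (hY.approx M t)
      (hZ.approx M t)).trans_eq (add_mul _ _ _).symm))
    congr 1; ext ω; simp only [Pi.sub_apply]; ring
  zero t ω := by simp [hY.zero, hZ.zero]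

lemma const_mul (hY : LocalApprox P ε Y Y' b C ρ) (c : ℝ) :
    LocalApprox P ε (fun t ω => c * Y t ω) (fun M t ω => c * Y' M t ω)
      (fun M => |c| * b M) (|c| * C) ρ where
  memLp t := (hY.memLp t).const_mul c
  meas M t := (hY.meas M t).const_mul c
  bdd M t ω := by rw [abs_mul]; exact mul_le_mul_of_nonneg_left (hY.bdd M t ω) (abs_nonneg _)
  approx M t := by
    simp only [← mul_sub, l2_const_mul, mul_assoc]
    exact mul_le_mul_of_nonneg_left (hY.approx M t) (abs_nonneg _)
  zero t ω := by simp [hY.zero]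

lemma finset_sum [IsProbabilityMeasure P] (hε : ∀ t, Measurable (ε t))
    {ι : Type*} (J : Finset ι)
    {Y : ι → ℤ → Ω → ℝ} {Y' : ι → ℕ → ℤ → Ω → ℝ} {b : ι → ℕ → ℝ} {C : ι → ℝ}
    (h : ∀ i ∈ J, LocalApprox P ε (Y i) (Y' i) (b i) (C i) ρ) :
    LocalApprox P ε (fun t ω => ∑ i ∈ J, Y i t ω) (fun M t ω => ∑ i ∈ J, Y' i M t ω)
      (fun M => ∑ i ∈ J, b i M) (∑ i ∈ J, C i) ρ := by
  classical
  induction J using Finset.induction_on with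
  | empty => exact ⟨by simp, by simp, by simp, by simp [l2], by simp⟩
  | insert i J hiJ ih =>
    simp only [Finset.sum_insert hiJ]
    exact (h i (Finset.mem_insert_self i J)).add
      (ih fun k hk => h k (Finset.mem_insert_of_mem hk)) hε

end LocalApprox

end LocalApprox

/-! ### From local sums to approximable arrays -/

section GaussianLimit

/-- The derivative is bounded by `1` because `|z| ≤ 1 + z²/2 ≤ exp(z²/2)`. The standard deviation is
the right variable here: it is 1-Lipschitz in `L²`. -/
lemma abs_exp_neg_sq_half_sub_le (x y : ℝ) :
    |Real.exp (-(x ^ 2 / 2)) - Real.exp (-(y ^ 2 / 2))| ≤ |x - y| := by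
  have hd : ∀ z : ℝ, HasDerivAt (fun z : ℝ => Real.exp (-(z ^ 2 / 2)))
      (Real.exp (-(z ^ 2 / 2)) * (-z)) z := fun z => by
    have h1 : HasDerivAt (fun z : ℝ => -(z ^ 2 / 2)) (-z) z :=
      ((hasDerivAt_pow 2 z).div_const 2).neg.congr_deriv (by norm_num)
    exact h1.exp
  have := Convex.norm_image_sub_le_of_norm_hasDerivWithin_le (C := 1) (s := Set.univ)
    (x := y) (y := x) (fun z _ => (hd z).hasDerivWithinAt) (fun z _ => by
      rw [norm_mul, Real.norm_eq_abs, Real.abs_exp, Real.exp_neg, norm_neg, Real.norm_eq_abs,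
        inv_mul_le_iff₀ (Real.exp_pos _), mul_one]
      have := Real.add_one_le_exp (z ^ 2 / 2)
      nlinarith [sq_nonneg (|z| - 1), sq_abs z]) convex_univ trivial trivial
  simpa using this

lemma norm_exp_mul_I_sub_exp_mul_I_le (x y : ℝ) :
    ‖Complex.exp (x * Complex.I) - Complex.exp (y * Complex.I)‖ ≤ |x - y| := by
  have e : Complex.exp (x * Complex.I) - Complex.exp (y * Complex.I)
      = Complex.exp (y * Complex.I) * (Complex.exp (Complex.I * (x - y : ℝ)) - 1) := by
    rw [mul_sub, ← Complex.exp_add, mul_one]; congr 2; push_cast; ring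
  rw [e, norm_mul, Complex.norm_exp_ofReal_mul_I, one_mul]
  exact Real.norm_exp_I_mul_ofReal_sub_one_le

variable {Ω E : Type*} [mΩ : MeasurableSpace Ω] [mE : MeasurableSpace E] {P : Measure Ω}

/-- Passing from `S` to `S'` costs `r` in the characteristic function and `r` again in the Gaussian
with matching variance. -/
lemma norm_charFun_gap_le [IsProbabilityMeasure P] {S S' : Ω → ℝ} (hS : MemLp S 2 P)
    (hS' : MemLp S' 2 P) {e r : ℝ} (hr : l2 P (fun ω => S ω - S' ω) ≤ r)
    (he : ‖∫ ω, Complex.exp (S' ω * Complex.I) ∂P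
      - (Real.exp (-((∫ ω, S' ω ^ 2 ∂P) / 2)) : ℝ)‖ ≤ e) :
    ‖∫ ω, Complex.exp (S ω * Complex.I) ∂P
      - (Real.exp (-((∫ ω, S ω ^ 2 ∂P) / 2)) : ℝ)‖ ≤ 2 * r + e := by
  have hint : ∀ {U : Ω → ℝ}, MemLp U 2 P → Integrable (fun ω => Complex.exp (U ω * Complex.I)) P :=
    fun {U} hU => Integrable.of_bound
      (((hU.aestronglyMeasurable.aemeasurable.complex_ofReal).mul_const _).cexp.aestronglyMeasurable)
      1 (.of_forall fun ω => (Complex.norm_exp_ofReal_mul_I _).le)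
  have h1 : ‖∫ ω, Complex.exp (S ω * Complex.I) ∂P - ∫ ω, Complex.exp (S' ω * Complex.I) ∂P‖
      ≤ r := by
    rw [← integral_sub (hint hS) (hint hS')]
    refine (norm_integral_le_integral_norm _).trans (le_trans ?_ hr)
    refine le_trans (integral_mono ((hint hS).sub (hint hS')).norm
      ((hS.sub hS').integrable one_le_two).abs fun ω => ?_) (integral_abs_le_l2 (hS.sub hS'))
    exact norm_exp_mul_I_sub_exp_mul_I_le _ _
  have h2 : ‖((Real.exp (-((∫ ω, S' ω ^ 2 ∂P) / 2)) : ℝ) : ℂ)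
      - (Real.exp (-((∫ ω, S ω ^ 2 ∂P) / 2)) : ℝ)‖ ≤ r := by
    rw [← Complex.ofReal_sub, Complex.norm_real, Real.norm_eq_abs, ← l2_sq, ← l2_sq]
    refine (abs_exp_neg_sq_half_sub_le _ _).trans ((abs_l2_sub_l2_le hS' hS).trans ?_)
    rwa [l2_sub_comm]
  calc _ = ‖(∫ ω, Complex.exp (S ω * Complex.I) ∂P - ∫ ω, Complex.exp (S' ω * Complex.I) ∂P)
        + (∫ ω, Complex.exp (S' ω * Complex.I) ∂P
          - (Real.exp (-((∫ ω, S' ω ^ 2 ∂P) / 2)) : ℝ))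
        + (((Real.exp (-((∫ ω, S' ω ^ 2 ∂P) / 2)) : ℝ) : ℂ)
          - (Real.exp (-((∫ ω, S ω ^ 2 ∂P) / 2)) : ℝ))‖ := by congr 1; ring
    _ ≤ r + e + r := (norm_add_le _ _).trans
        (add_le_add ((norm_add_le _ _).trans (add_le_add h1 he)) h2)
    _ = 2 * r + e := by ring

/-- Asymptotic normality of weighted sums over arrays which are uniformly approximated by bounded
local variables, in terms of characteristic functions at `1`. -/
theorem tendsto_charFun_weighted_sum [IsProbabilityMeasure P] {ε : ℤ → Ω → E}
    (hε : ∀ t, Measurable (ε t)) (hi : iIndepFun ε P) {C ρ : ℝ} (hρ : ρ ∈ Set.Ioo (0 : ℝ) 1)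
    {Y : ℕ → ℤ → Ω → ℝ} {Y' : ℕ → ℕ → ℤ → Ω → ℝ} {b : ℕ → ℝ}
    (hY : ∀ T, LocalApprox P ε (Y T) (Y' T) b C ρ) {I : ℕ → Finset ℤ} {w : ℕ → ℤ → ℝ} {c : ℝ}
    (hc : 0 ≤ c) (hw : ∀ T, ∀ t ∈ I T, |w T t| ≤ c / √((I T).card : ℝ))
    (hI : Tendsto (fun T => (I T).card) atTop atTop) :
    Tendsto (fun T => ∫ ω, Complex.exp
        ((∑ t ∈ I T, w T t * (Y T t ω - ∫ ω', Y T t ω' ∂P) : ℝ) * Complex.I) ∂P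
      - (Real.exp (-((∫ ω, (∑ t ∈ I T, w T t * (Y T t ω - ∫ ω', Y T t ω' ∂P)) ^ 2 ∂P) / 2)) : ℝ))
      atTop (𝓝 0) := by
  classical
  have hb : ∀ M, 0 ≤ b M := fun M => by
    obtain ⟨ω⟩ : Nonempty Ω := nonempty_of_isProbabilityMeasure P
    exact (abs_nonneg _).trans ((hY 0).bdd M 0 ω)
  set K : ℝ := 3 * C ^ 2 * (∑' h, ρ ^ gap h) * c ^ 2 with hK
  set n : ℕ → ℝ := fun T => ((I T).card : ℝ) with hn
  have hnT : Tendsto n atTop atTop := tendsto_natCast_atTop_atTop.comp hI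
  have hsq : ∀ T, ∑ t ∈ I T, w T t ^ 2 ≤ c ^ 2 := fun T => by
    rcases (I T).eq_empty_or_nonempty with h0 | h0
    · simpa [h0] using sq_nonneg c
    have hpos : (0 : ℝ) < (I T).card := by exact_mod_cast h0.card_pos
    refine (Finset.sum_le_card_nsmul _ _ (c ^ 2 / (I T).card) fun t ht => ?_).trans_eq ?_
    · have := pow_le_pow_left₀ (abs_nonneg _) (hw T t ht) 2
      rwa [sq_abs, div_pow, Real.sq_sqrt hpos.le] at this
    · rw [nsmul_eq_mul]; field_simp
  -- These are the Stein errors with `n` summands bounded by `β = 2 c (b M) / √n`: `n β⁴` is of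
  -- order `1/n` and `n β³` of order `1/√n`. The factor `2` in `β` comes from centring.
  set err : ℕ → ℕ → ℝ := fun M T =>
    √(12 * M * (4 * M) ^ 2 * ((2 * c * b M) ^ 4 * (n T)⁻¹))
      + 2 * (4 * M) ^ 2 * ((2 * c * b M) ^ 3 * (√(n T))⁻¹) with herr
  have hbound : ∀ M T, 0 < n T → ‖∫ ω, Complex.exp
        ((∑ t ∈ I T, w T t * (Y T t ω - ∫ ω', Y T t ω' ∂P) : ℝ) * Complex.I) ∂P
      - (Real.exp (-((∫ ω, (∑ t ∈ I T, w T t * (Y T t ω - ∫ ω', Y T t ω' ∂P)) ^ 2 ∂P) / 2))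
        : ℝ)‖ ≤ 2 * √(K * ρ ^ M) + err M T := by
    intro M T hpos
    have hYM := (hY T).memLp' hε
    refine norm_charFun_gap_le
      (S' := fun ω => ∑ t ∈ I T, w T t * (Y' T M t ω - ∫ ω', Y' T M t ω' ∂P))
      (memLp_finsetSum _ fun t _ => (memLp_sub_mean ((hY T).memLp t)).const_mul _)
      (memLp_finsetSum _ fun t _ => (memLp_sub_mean (hYM M t)).const_mul _)
      ((hY T).l2_sum_sub_le hε hi hρ (I T) (w T) (hsq T) M) ?_
    -- The weights are controlled only on `I T`, whereas the Stein bound wants every `ξ t` bounded;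
    -- hence the extension by zero.
    set ξ : ℤ → Ω → ℝ := fun t ω =>
      (if t ∈ I T then w T t else 0) * (Y' T M t ω - ∫ ω', Y' T M t ω' ∂P) with hξ
    have hsum : ∀ ω, ∑ t ∈ I T, w T t * (Y' T M t ω - ∫ ω', Y' T M t ω' ∂P)
        = ∑ t ∈ I T, ξ t ω := fun ω =>
      Finset.sum_congr rfl fun t ht => by simp [hξ, ht]
    simp only [hsum]
    have hβ : 0 ≤ 2 * c * b M * (√(n T))⁻¹ := by have := hb M; positivity
    refine (norm_charFun_sub_gaussian_le hε hi (M := M) (ξ := ξ) (fun t => ?_) hβ (fun t ω => ?_)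
      (fun t => ?_) (I T)).trans (le_of_eq ?_)
    · exact (((hY T).meas M t).sub_const _).const_mul _
    · have h1 : |(if t ∈ I T then w T t else 0)| ≤ c * (√(n T))⁻¹ := by
        split_ifs with ht
        · exact hw T t ht
        · rw [abs_zero]; positivity
      have h2 : |∫ ω', Y' T M t ω' ∂P| ≤ b M := by
        refine (norm_integral_le_of_norm_le_const (f := Y' T M t)
          (.of_forall ((hY T).bdd M t))).trans_eq ?_
        rw [probReal_univ, mul_one]
      have h3 := (abs_sub _ _).trans (add_le_add ((hY T).bdd M t ω) h2)
      rw [hξ, abs_mul]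
      refine (mul_le_mul h1 h3 (abs_nonneg _) (by positivity)).trans_eq (by ring)
    · simp only [hξ]
      rw [integral_const_mul, integral_sub ((hYM M t).integrable one_le_two)
        (integrable_const _)]
      simp
    · have hs : √(n T) ^ 2 = n T := Real.sq_sqrt hpos.le
      have hs0 : √(n T) ≠ 0 := (Real.sqrt_pos.2 hpos).ne'
      have hi2 : (√(n T))⁻¹ ^ 2 = (n T)⁻¹ := by rw [inv_pow, hs]
      rw [herr]
      change √(n T * _ * _) + n T * _ = _
      congr 1
      · congr 1
        have : n T * (n T)⁻¹ = 1 := mul_inv_cancel₀ hpos.ne'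
        calc _ = 12 * M * (4 * M) ^ 2 * (2 * c * b M) ^ 4 *
              (n T * ((√(n T))⁻¹ ^ 2) * ((√(n T))⁻¹ ^ 2)) := by ring
          _ = _ := by rw [hi2, this]; ring
      · have : n T * (n T)⁻¹ = 1 := mul_inv_cancel₀ hpos.ne'
        calc _ = 2 * (4 * M) ^ 2 * ((2 * c * b M) ^ 3 *
              (n T * ((√(n T))⁻¹ ^ 2) * (√(n T))⁻¹)) := by ring
          _ = _ := by rw [hi2, this]; ring
  have herr0 : ∀ M, Tendsto (err M) atTop (𝓝 0) := fun M => by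
    have h1 : Tendsto (fun T => (n T)⁻¹) atTop (𝓝 0) := tendsto_inv_atTop_zero.comp hnT
    have h2 : Tendsto (fun T => (√(n T))⁻¹) atTop (𝓝 0) :=
      tendsto_inv_atTop_zero.comp (Real.tendsto_sqrt_atTop.comp hnT)
    have h3 := ((h1.const_mul ((2 * c * b M) ^ 4)).const_mul
      (12 * (M : ℝ) * (4 * M) ^ 2)).sqrt
    have h4 := (h2.const_mul ((2 * c * b M) ^ 3)).const_mul (2 * (4 * (M : ℝ)) ^ 2)
    simpa using h3.add h4
  have hM0 : Tendsto (fun M : ℕ => 2 * √(K * ρ ^ M)) atTop (𝓝 0) := by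
    simpa using (((tendsto_pow_atTop_nhds_zero_of_lt_one hρ.1.le hρ.2).const_mul K).sqrt).const_mul 2
  rw [Metric.tendsto_atTop]
  intro r hr
  -- Order of limits: `M` is fixed first, the localization error being uniform in `T`; then `T` is
  -- taken large for this `M`.
  obtain ⟨M, hM⟩ := ((tendsto_order.1 hM0).2 (r / 2) (by positivity)).exists
  obtain ⟨T₀, hT₀⟩ := eventually_atTop.1 (((tendsto_order.1 (herr0 M)).2 (r / 2)
    (by positivity)).and (hnT.eventually_gt_atTop 0))
  refine ⟨T₀, fun T hT => ?_⟩
  rw [dist_zero_right]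
  have := hbound M T (hT₀ T hT).2
  linarith [(hT₀ T hT).1]

end GaussianLimit

/-! ### The `ℓ¹` norm and the maximum column sum -/

section Norms

variable {d : ℕ}

lemma vecNorm1_nonneg (x : Fin d → ℝ) : 0 ≤ vecNorm1 x := Finset.sum_nonneg fun _ _ => abs_nonneg _

lemma vecNorm1_zero : vecNorm1 (0 : Fin d → ℝ) = 0 := by simp [vecNorm1]

lemma vecNorm1_add_le (x y : Fin d → ℝ) : vecNorm1 (x + y) ≤ vecNorm1 x + vecNorm1 y := by
  unfold vecNorm1
  rw [← Finset.sum_add_distrib]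
  exact Finset.sum_le_sum fun i _ => abs_add_le _ _

lemma continuous_vecNorm1 : Continuous (vecNorm1 : (Fin d → ℝ) → ℝ) := by
  unfold vecNorm1; fun_prop

lemma norm_le_vecNorm1 (x : Fin d → ℝ) : ‖x‖ ≤ vecNorm1 x :=
  (pi_norm_le_iff_of_nonneg (vecNorm1_nonneg x)).2 fun i =>
    Finset.single_le_sum (f := fun i => |x i|) (fun _ _ => abs_nonneg _) (Finset.mem_univ i)

lemma vecNorm1_le (x : Fin d → ℝ) : vecNorm1 x ≤ d * ‖x‖ := by
  refine (Finset.sum_le_card_nsmul _ _ ‖x‖ fun i _ => norm_le_pi_norm x i).trans_eq ?_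
  simp

lemma sum_abs_le_matNorm1 (A : Matrix (Fin d) (Fin d) ℝ) (q : Fin d) :
    ∑ p, |A p q| ≤ matNorm1 A :=
  le_ciSup (f := fun q => ∑ p, |A p q|) (Set.finite_range _).bddAbove q

lemma matNorm1_nonneg (A : Matrix (Fin d) (Fin d) ℝ) : 0 ≤ matNorm1 A :=
  Real.iSup_nonneg fun _ => Finset.sum_nonneg fun _ _ => abs_nonneg _

lemma matNorm1_le {A : Matrix (Fin d) (Fin d) ℝ} {c : ℝ} (hc : 0 ≤ c)
    (h : ∀ p q, |A p q| ≤ c) : matNorm1 A ≤ d * c :=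
  Real.iSup_le (fun q => (Finset.sum_le_sum fun p _ => h p q).trans_eq (by simp))
    (mul_nonneg (Nat.cast_nonneg d) hc)

lemma matNorm1_add_le (A A' : Matrix (Fin d) (Fin d) ℝ) :
    matNorm1 (A + A') ≤ matNorm1 A + matNorm1 A' := by
  refine Real.iSup_le (fun q => le_trans ?_
    (add_le_add (sum_abs_le_matNorm1 A q) (sum_abs_le_matNorm1 A' q)))
    (add_nonneg (matNorm1_nonneg _) (matNorm1_nonneg _))
  rw [← Finset.sum_add_distrib]
  exact Finset.sum_le_sum fun p _ => abs_add_le _ _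

lemma matNorm1_zero : matNorm1 (0 : Matrix (Fin d) (Fin d) ℝ) = 0 := by simp [matNorm1]

lemma vecNorm1_mulVec_le (A : Matrix (Fin d) (Fin d) ℝ) (x : Fin d → ℝ) :
    vecNorm1 (A *ᵥ x) ≤ matNorm1 A * vecNorm1 x := by
  calc vecNorm1 (A *ᵥ x) ≤ ∑ p, ∑ q, |A p q| * |x q| := by
        simp only [vecNorm1, Matrix.mulVec, dotProduct, ← abs_mul]
        exact Finset.sum_le_sum fun p _ => Finset.abs_sum_le_sum_abs _ _
    _ = ∑ q, (∑ p, |A p q|) * |x q| := by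
        rw [Finset.sum_comm]; exact Finset.sum_congr rfl fun q _ => (Finset.sum_mul _ _ _).symm
    _ ≤ ∑ q, matNorm1 A * |x q| := Finset.sum_le_sum fun q _ =>
        mul_le_mul_of_nonneg_right (sum_abs_le_matNorm1 A q) (abs_nonneg _)
    _ = _ := (Finset.mul_sum _ _ _).symm

lemma vecNorm1_tsum_le {v : ℤ → Fin d → ℝ} (h : Summable fun j => vecNorm1 (v j)) :
    vecNorm1 (∑' j, v j) ≤ ∑' j, vecNorm1 (v j) := by
  have hv : Summable v := Summable.of_norm_bounded h fun j => norm_le_vecNorm1 _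
  refine le_of_tendsto_of_tendsto' ((continuous_vecNorm1.tendsto _).comp hv.hasSum) h.hasSum
    fun F => ?_
  induction F using Finset.cons_induction with
  | empty => simp [vecNorm1_zero]
  | cons a F ha ih =>
    simp only [Function.comp_apply, Finset.sum_cons] at ih ⊢
    exact (vecNorm1_add_le _ _).trans (by linarith)

lemma continuous_of_vecNorm1_lipschitz {g : (Fin d → ℝ) → ℝ} {L : ℝ}
    (h : ∀ x y, |g x - g y| ≤ L * vecNorm1 (x - y)) : Continuous g := by
  refine (LipschitzWith.of_dist_le_mul (K := Real.toNNReal (|L| * d)) fun x y => ?_).continuous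
  rw [Real.coe_toNNReal _ (by positivity), Real.dist_eq, dist_eq_norm, mul_assoc]
  exact (h x y).trans (mul_le_mul (le_abs_self L) (vecNorm1_le _) (vecNorm1_nonneg _)
    (abs_nonneg _))

end Norms

/-! ### Linear processes and their `L¹` perturbation -/

section LinearProcess

variable {Ω : Type*} {d : ℕ}

/-- The stochastic part `∑_{j ∈ ℤ} a(j) ε_{t-j}` of a linear process. -/
def linProc (ε : ℤ → Ω → Fin d → ℝ) (a : ℤ → Matrix (Fin d) (Fin d) ℝ) (t : ℤ) (ω : Ω) :
    Fin d → ℝ := ∑' j : ℤ, a j *ᵥ ε (t - j) ω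

/-- The coefficients restricted to `|j| < M`. -/
def truncCoeff (a : ℤ → Matrix (Fin d) (Fin d) ℝ) (M : ℕ) (j : ℤ) : Matrix (Fin d) (Fin d) ℝ :=
  if j ∈ Finset.Ioo (-(M : ℤ)) (M : ℤ) then a j else 0

/-- The random variable `∑_{j ∈ ℤ} r^{|j|} |ε_{t-j}|₁`. -/
def envelope (ε : ℤ → Ω → Fin d → ℝ) (r : ℝ) (t : ℤ) (ω : Ω) : ℝ :=
  ∑' j : ℤ, r ^ j.natAbs * vecNorm1 (ε (t - j) ω)

lemma linProc_truncCoeff (ε : ℤ → Ω → Fin d → ℝ) (a : ℤ → Matrix (Fin d) (Fin d) ℝ) (M : ℕ)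
    (t : ℤ) (ω : Ω) :
    linProc ε (truncCoeff a M) t ω = ∑ j ∈ Finset.Ioo (-(M : ℤ)) (M : ℤ), a j *ᵥ ε (t - j) ω := by
  rw [linProc, tsum_eq_sum (s := Finset.Ioo (-(M : ℤ)) (M : ℤ))]
  · exact Finset.sum_congr rfl fun j hj => by rw [truncCoeff, if_pos hj]
  · intro j hj
    rw [truncCoeff, if_neg hj, Matrix.zero_mulVec]

lemma matNorm1_truncCoeff_le {a : ℤ → Matrix (Fin d) (Fin d) ℝ} {c : ℤ → ℝ}
    (h : ∀ j, matNorm1 (a j) ≤ c j) (M : ℕ) (j : ℤ) : matNorm1 (truncCoeff a M j) ≤ c j := by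
  rw [truncCoeff]
  split_ifs
  · exact h j
  · rw [matNorm1_zero]; exact (matNorm1_nonneg _).trans (h j)

/-- Only `|j| ≥ M` contributes, so the rate `r²` can be split: one factor `r` yields `r^M`, the
other keeps the series over `j` summable. -/
lemma matNorm1_sub_truncCoeff_le {a : ℤ → Matrix (Fin d) (Fin d) ℝ} {B r : ℝ} (hB : 0 ≤ B)
    (hr : r ∈ Set.Ioo (0 : ℝ) 1) (h : ∀ j, matNorm1 (a j) ≤ B * (r ^ 2) ^ j.natAbs) (M : ℕ)
    (j : ℤ) : matNorm1 (a j - truncCoeff a M j) ≤ B * r ^ M * r ^ j.natAbs := by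
  have hr0 := hr.1.le
  rw [truncCoeff]
  split_ifs with hj
  · rw [sub_self, matNorm1_zero]; positivity
  · rw [sub_zero, mul_assoc, ← pow_add]
    refine (h j).trans (mul_le_mul_of_nonneg_left ?_ hB)
    rw [← pow_mul]
    refine pow_le_pow_of_le_one hr0 hr.2.le ?_
    rw [Finset.mem_Ioo] at hj
    omega

/-- Summability of the envelope makes both series converge, so the difference of the `tsum`s may be
taken termwise. -/
lemma vecNorm1_linProc_sub_le {ε : ℤ → Ω → Fin d → ℝ} {a b : ℤ → Matrix (Fin d) (Fin d) ℝ}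
    {D D' r : ℝ} (ha : ∀ j, matNorm1 (a j) ≤ D' * r ^ j.natAbs)
    (hb : ∀ j, matNorm1 (b j) ≤ D' * r ^ j.natAbs)
    (hab : ∀ j, matNorm1 (a j - b j) ≤ D * r ^ j.natAbs) {t : ℤ} {ω : Ω}
    (hs : Summable fun j : ℤ => r ^ j.natAbs * vecNorm1 (ε (t - j) ω)) :
    vecNorm1 (linProc ε a t ω - linProc ε b t ω) ≤ D * envelope ε r t ω := by
  have hle : ∀ {c : ℤ → Matrix (Fin d) (Fin d) ℝ} {L : ℝ},
      (∀ j, matNorm1 (c j) ≤ L * r ^ j.natAbs) → ∀ j,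
      vecNorm1 (c j *ᵥ ε (t - j) ω) ≤ L * (r ^ j.natAbs * vecNorm1 (ε (t - j) ω)) := by
    intro c L hc j
    rw [← mul_assoc]
    exact (vecNorm1_mulVec_le _ _).trans
      (mul_le_mul_of_nonneg_right (hc j) (vecNorm1_nonneg _))
  have hsum : ∀ {c : ℤ → Matrix (Fin d) (Fin d) ℝ} {L : ℝ},
      (∀ j, matNorm1 (c j) ≤ L * r ^ j.natAbs) → Summable fun j => c j *ᵥ ε (t - j) ω :=
    fun hc => Summable.of_norm_bounded (hs.mul_left _)
      fun j => (norm_le_vecNorm1 _).trans (hle hc j)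
  have hsd : Summable fun j => vecNorm1 ((a j - b j) *ᵥ ε (t - j) ω) :=
    Summable.of_nonneg_of_le (fun _ => vecNorm1_nonneg _) (hle hab) (hs.mul_left _)
  rw [linProc, linProc, ← (hsum ha).tsum_sub (hsum hb)]
  simp only [← Matrix.sub_mulVec]
  refine (vecNorm1_tsum_le hsd).trans ?_
  rw [envelope, ← tsum_mul_left]
  exact hsd.tsum_le_tsum (hle hab) (hs.mul_left _)

lemma measurable_linProc [MeasurableSpace Ω] {ε : ℤ → Ω → Fin d → ℝ} (hε : ∀ t, Measurable (ε t))
    (a : ℤ → Matrix (Fin d) (Fin d) ℝ) (t : ℤ) : Measurable (linProc ε a t) :=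
  Measurable.tsum fun j =>
    (Continuous.matrix_mulVec continuous_const continuous_id).measurable.comp (hε (t - j))

section Integrability

variable [MeasurableSpace Ω] {P : Measure Ω} {ε : ℤ → Ω → Fin d → ℝ}

lemma integrable_vecNorm1_innov (hid : ∀ t, IdentDistrib (ε t) (ε 1) P P)
    (hint : Integrable (ε 1) P) (t : ℤ) :
    Integrable (fun ω => vecNorm1 (ε t ω)) P ∧
      ∫ ω, vecNorm1 (ε t ω) ∂P = ∫ ω, vecNorm1 (ε 1 ω) ∂P := by
  have h1 : IdentDistrib (fun ω => vecNorm1 (ε t ω)) (fun ω => vecNorm1 (ε 1 ω)) P P :=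
    (hid t).comp continuous_vecNorm1.measurable
  refine ⟨h1.integrable_iff.2 ?_, h1.integral_eq⟩
  unfold vecNorm1
  exact integrable_finsetSum _ fun i _ => (hint.eval i).abs

/-- Tonelli: the expected sum is a geometric series times the first absolute moment of one
innovation. -/
lemma ae_summable_envelope (hid : ∀ t, IdentDistrib (ε t) (ε 1) P P)
    (hint : Integrable (ε 1) P) {r : ℝ} (hr : r ∈ Set.Ioo (0 : ℝ) 1) (t : ℤ) :
    (∀ᵐ ω ∂P, Summable fun j : ℤ => r ^ j.natAbs * vecNorm1 (ε (t - j) ω)) ∧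
      Integrable (envelope ε r t) P ∧
      ∫ ω, envelope ε r t ω ∂P = (∑' j : ℤ, r ^ j.natAbs) * ∫ ω, vecNorm1 (ε 1 ω) ∂P := by
  set F : ℤ → Ω → ℝ := fun j ω => r ^ j.natAbs * vecNorm1 (ε (t - j) ω) with hF
  have hF0 : ∀ j ω, 0 ≤ F j ω := fun j ω =>
    mul_nonneg (pow_nonneg hr.1.le _) (vecNorm1_nonneg _)
  have hFi : ∀ j, Integrable (F j) P := fun j =>
    (integrable_vecNorm1_innov hid hint (t - j)).1.const_mul _
  have hFe : ∀ j, ∫ ω, F j ω ∂P = r ^ j.natAbs * ∫ ω, vecNorm1 (ε 1 ω) ∂P := fun j => by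
    rw [hF, integral_const_mul, (integrable_vecNorm1_innov hid hint (t - j)).2]
  have hs : Summable fun j => ∫ ω, F j ω ∂P := by
    simp only [hFe]
    exact (summable_pow_natAbs hr.1.le hr.2).mul_right _
  have hlt : ∫⁻ ω, ∑' j, ‖F j ω‖ₑ ∂P ≠ ∞ := by
    rw [lintegral_tsum fun j => (hFi j).aestronglyMeasurable.enorm]
    have : ∀ j, ∫⁻ ω, ‖F j ω‖ₑ ∂P = ENNReal.ofReal (∫ ω, F j ω ∂P) := fun j => by
      rw [← ofReal_integral_norm_eq_lintegral_enorm (hFi j)]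
      simp only [Real.norm_of_nonneg (hF0 j _)]
    simp only [this]
    exact hs.tsum_ofReal_ne_top
  have hae : ∀ᵐ ω ∂P, Summable fun j => F j ω := by
    filter_upwards [ae_lt_top' (AEMeasurable.tsum fun j =>
      (hFi j).aestronglyMeasurable.enorm) hlt] with ω hω
    exact (tsum_enorm_ne_top_iff_summable_norm.1 hω.ne).of_norm
  refine ⟨hae, ?_, ?_⟩
  · refine ⟨(AEMeasurable.tsum fun j => (hFi j).aestronglyMeasurable.aemeasurable
      ).aestronglyMeasurable, ?_⟩
    exact (lintegral_mono fun ω => enorm_tsum_le_tsum_enorm).trans_lt hlt.lt_top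
  · have h := hasSum_integral_of_summable_integral_norm hFi
      (by simpa only [Real.norm_of_nonneg (hF0 _ _)] using hs)
    refine h.tsum_eq.symm.trans ?_
    simp only [hFe, tsum_mul_right]

lemma integral_abs_lipschitz_linProc_sub_le [IsProbabilityMeasure P]
    (hid : ∀ t, IdentDistrib (ε t) (ε 1) P P)
    (hint : Integrable (ε 1) P) {r : ℝ} (hr : r ∈ Set.Ioo (0 : ℝ) 1)
    {a b : ℤ → Matrix (Fin d) (Fin d) ℝ} {D D' L : ℝ}
    (ha : ∀ j, matNorm1 (a j) ≤ D' * r ^ j.natAbs)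
    (hb : ∀ j, matNorm1 (b j) ≤ D' * r ^ j.natAbs)
    (hab : ∀ j, matNorm1 (a j - b j) ≤ D * r ^ j.natAbs)
    {g : (Fin d → ℝ) → ℝ} (hg : ∀ x y, |g x - g y| ≤ L * vecNorm1 (x - y))
    (m m' : Fin d → ℝ) (t : ℤ) :
    ∫ ω, |g (m + linProc ε a t ω) - g (m' + linProc ε b t ω)| ∂P
      ≤ |L| * (vecNorm1 (m - m')
        + D * ((∑' j : ℤ, r ^ j.natAbs) * ∫ ω, vecNorm1 (ε 1 ω) ∂P)) := by
  obtain ⟨h1, h2, h3⟩ := ae_summable_envelope hid hint hr t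
  rw [← h3]
  refine (integral_mono_of_nonneg (.of_forall fun _ => abs_nonneg _)
    (g := fun ω => |L| * (vecNorm1 (m - m') + D * envelope ε r t ω))
    (((integrable_const _).add (h2.const_mul D)).const_mul _) ?_).trans_eq ?_
  · filter_upwards [h1] with ω hω
    refine (hg _ _).trans (mul_le_mul (le_abs_self L) ?_ (vecNorm1_nonneg _) (abs_nonneg _))
    rw [add_sub_add_comm]
    exact (vecNorm1_add_le _ _).trans
      (add_le_add_right (vecNorm1_linProc_sub_le ha hb hab hω) _)
  · rw [integral_const_mul, integral_add (integrable_const _) (h2.const_mul D),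
      integral_const_mul]
    simp

end Integrability

end LinearProcess

/-! ### Interpolating `L¹` and `L^(2+δ)` to `L²` -/

section Moments

variable {Ω : Type*} [MeasurableSpace Ω] {P : Measure Ω} [IsProbabilityMeasure P]

lemma moment_facts {V : Ω → ℝ} (hV : Measurable V) {δ : ℝ} (hδ : 0 < δ) {K : ℝ≥0}
    (h : ∫⁻ ω, ‖V ω‖ₑ ^ (2 + δ) ∂P ≤ K) :
    MemLp V 2 P ∧ Integrable (fun ω => |V ω| ^ (2 + δ)) P ∧ ∫ ω, |V ω| ^ (2 + δ) ∂P ≤ K := by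
  have hp : (ENNReal.ofReal (2 + δ)).toReal = 2 + δ := ENNReal.toReal_ofReal (by linarith)
  have hp0 : ENNReal.ofReal (2 + δ) ≠ 0 := by
    rw [Ne, ENNReal.ofReal_eq_zero]; linarith
  have hL : MemLp V (ENNReal.ofReal (2 + δ)) P := by
    refine ⟨hV.aestronglyMeasurable, ?_⟩
    rw [eLpNorm_lt_top_iff_lintegral_rpow_enorm_lt_top hp0 ENNReal.ofReal_ne_top, hp]
    exact h.trans_lt ENNReal.coe_lt_top
  have hi : Integrable (fun ω => |V ω| ^ (2 + δ)) P := by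
    have := hL.integrable_norm_rpow hp0 ENNReal.ofReal_ne_top
    rwa [hp] at this
  refine ⟨hL.mono_exponent ?_, hi, ?_⟩
  · rw [← ENNReal.ofReal_ofNat]; exact ENNReal.ofReal_le_ofReal (by linarith)
  · rw [integral_eq_lintegral_of_nonneg_ae (.of_forall fun _ => by positivity)
      hi.aestronglyMeasurable]
    refine ENNReal.toReal_le_of_le_ofReal K.2 ?_
    rw [ENNReal.ofReal_coe_nnreal]
    refine le_trans (le_of_eq (lintegral_congr fun ω => ?_)) h
    rw [← Real.norm_eq_abs, ← ENNReal.ofReal_rpow_of_nonneg (norm_nonneg _) (by linarith),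
      ofReal_norm]

lemma sq_le_rpow_of_le {x R δ : ℝ} (hR : 0 < R) (hδ : 0 ≤ δ) (h : R ≤ x) :
    x ^ 2 ≤ R ^ (-δ) * x ^ (2 + δ) := by
  have hx : 0 < x := hR.trans_le h
  rw [Real.rpow_add hx, Real.rpow_two, Real.rpow_neg hR.le, ← div_eq_inv_mul, le_div_iff₀
    (Real.rpow_pos_of_pos hR δ)]
  exact mul_le_mul_of_nonneg_left (Real.rpow_le_rpow hR.le h hδ) (sq_nonneg _)

/-- Truncation of a real number to `[-L, L]`. -/
def clamp (L x : ℝ) : ℝ := max (-L) (min L x)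

lemma abs_clamp_le {L : ℝ} (hL : 0 ≤ L) (x : ℝ) : |clamp L x| ≤ L := by
  rw [clamp, abs_le]
  exact ⟨le_max_left _ _, max_le (by linarith) (min_le_left _ _)⟩

lemma measurable_clamp (L : ℝ) : Measurable (clamp L) :=
  measurable_const.max (measurable_const.min measurable_id)

lemma sq_sub_clamp_le {L δ : ℝ} (hL : 0 < L) (hδ : 0 ≤ δ) (x : ℝ) :
    (x - clamp L x) ^ 2 ≤ L ^ (-δ) * |x| ^ (2 + δ) := by
  rcases le_or_gt |x| L with h | h
  · have h1 : clamp L x = x := by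
      rw [clamp, min_eq_right (abs_le.1 h).2, max_eq_right (abs_le.1 h).1]
    rw [h1, sub_self, zero_pow two_ne_zero]
    positivity
  · refine le_trans ?_ (sq_le_rpow_of_le hL hδ h.le)
    rw [sq_le_sq, abs_abs]
    rcases lt_abs.1 h with h1 | h1
    · rw [clamp, min_eq_left h1.le, max_eq_right (by linarith), abs_of_pos (by linarith : 0 < x),
        abs_of_pos (by linarith : 0 < x - L)]
      linarith
    · rw [clamp, min_eq_right (by linarith), max_eq_left (by linarith),
        abs_of_neg (by linarith : x < 0), abs_of_neg (by linarith : x - -L < 0)]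
      linarith

/-- If `|x - y| > R`, the larger of `|x|` and `|y|`, say `|z|`, exceeds `R/2`. The `8` is `4` from
`(2|z|)²` times `2` from `2^δ ≤ 2`. -/
lemma sq_sub_le {R δ : ℝ} (hR : 0 < R) (hδ : 0 ≤ δ) (hδ1 : δ ≤ 1) (x y : ℝ) :
    (x - y) ^ 2 ≤ R * |x - y| + 8 * R ^ (-δ) * (|x| ^ (2 + δ) + |y| ^ (2 + δ)) := by
  rcases le_or_gt |x - y| R with h | h
  · have : (x - y) ^ 2 ≤ R * |x - y| := by
      rw [← sq_abs, sq]; exact mul_le_mul_of_nonneg_right h (abs_nonneg _)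
    have : 0 ≤ 8 * R ^ (-δ) * (|x| ^ (2 + δ) + |y| ^ (2 + δ)) := by positivity
    linarith
  · have key : ∀ z : ℝ, |x - y| ≤ 2 * |z| → (x - y) ^ 2 ≤ 8 * R ^ (-δ) * |z| ^ (2 + δ) := by
      intro z hz
      have h1 : R / 2 ≤ |z| := by linarith
      have h2 := sq_le_rpow_of_le (by positivity) hδ h1
      have h3 : (R / 2) ^ (-δ) ≤ 2 * R ^ (-δ) := by
        rw [Real.div_rpow hR.le zero_le_two, Real.rpow_neg zero_le_two, div_inv_eq_mul, mul_comm]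
        refine mul_le_mul_of_nonneg_right ?_ (by positivity)
        calc (2 : ℝ) ^ δ ≤ 2 ^ (1 : ℝ) := Real.rpow_le_rpow_of_exponent_le one_le_two hδ1
          _ = 2 := Real.rpow_one 2
      have h4 : (x - y) ^ 2 ≤ (2 * |z|) ^ 2 := by
        rw [← sq_abs]; exact pow_le_pow_left₀ (abs_nonneg _) hz 2
      have h5 : 0 ≤ |z| ^ (2 + δ) := by positivity
      have h6 := mul_le_mul_of_nonneg_right h3 h5
      nlinarith
    have h0 : 0 ≤ R * |x - y| := by positivity
    have hx : 0 ≤ 8 * R ^ (-δ) * |x| ^ (2 + δ) := by positivity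
    have hy : 0 ≤ 8 * R ^ (-δ) * |y| ^ (2 + δ) := by positivity
    have h1 := abs_sub x y
    rw [mul_add]
    rcases le_total |x| |y| with h2 | h2
    · linarith [key y (by linarith)]
    · linarith [key x (by linarith)]

lemma l2_le_of_moment {V : Ω → ℝ} (hV : Measurable V) {δ : ℝ} (hδ : 0 < δ) {K : ℝ≥0}
    (h : ∫⁻ ω, ‖V ω‖ₑ ^ (2 + δ) ∂P ≤ K) : l2 P V ≤ √(1 + K) := by
  obtain ⟨h2, hi, hK⟩ := moment_facts hV hδ h
  refine Real.sqrt_le_sqrt ?_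
  refine (integral_mono h2.integrable_sq ((integrable_const (1 : ℝ)).add hi) fun ω => ?_).trans ?_
  · rcases le_or_gt |V ω| 1 with h1 | h1
    · have : V ω ^ 2 ≤ 1 := by rw [← sq_abs]; exact pow_le_one₀ (abs_nonneg _) h1
      have h0 : 0 ≤ |V ω| ^ (2 + δ) := by positivity
      simp only [Pi.add_apply]; linarith
    · have := sq_le_rpow_of_le one_pos hδ.le h1.le
      rw [Real.one_rpow, one_mul, sq_abs] at this
      simp only [Pi.add_apply]; linarith
  · rw [integral_add' (integrable_const _) hi]
    simpa using hK

lemma l2_sub_clamp_le {V : Ω → ℝ} (hV : Measurable V) {δ : ℝ} (hδ : 0 < δ) {K : ℝ≥0}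
    (h : ∫⁻ ω, ‖V ω‖ₑ ^ (2 + δ) ∂P ≤ K) {R : ℝ} (hR : 0 < R) :
    l2 P (fun ω => V ω - clamp R (V ω)) ≤ √(K * R ^ (-δ)) := by
  obtain ⟨h2, hi, hK⟩ := moment_facts hV hδ h
  refine Real.sqrt_le_sqrt ?_
  refine (integral_mono_of_nonneg (.of_forall fun _ => sq_nonneg _) (hi.const_mul (R ^ (-δ)))
    (.of_forall fun ω => sq_sub_clamp_le hR hδ.le _)).trans ?_
  rw [integral_const_mul, mul_comm]
  exact mul_le_mul_of_nonneg_right hK (by positivity)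

/-- The level `R` stays free so that it can grow while `R τ` still vanishes: it is `clampLevel ϑ M`
for the local approximation and `√T` for the comparison with the companion. -/
lemma l2_sub_le_of_moment {V W : Ω → ℝ} (hV : Measurable V) (hW : Measurable W) {δ : ℝ}
    (hδ : 0 < δ) (hδ1 : δ ≤ 1) {K : ℝ≥0} (h : ∫⁻ ω, ‖V ω‖ₑ ^ (2 + δ) ∂P ≤ K)
    (h' : ∫⁻ ω, ‖W ω‖ₑ ^ (2 + δ) ∂P ≤ K) {τ : ℝ} (hτ : ∫ ω, |V ω - W ω| ∂P ≤ τ)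
    {R : ℝ} (hR : 0 < R) :
    l2 P (fun ω => V ω - W ω) ≤ √(R * τ + 16 * K * R ^ (-δ)) := by
  obtain ⟨h2, hi, hK⟩ := moment_facts hV hδ h
  obtain ⟨h2', hi', hK'⟩ := moment_facts hW hδ h'
  refine Real.sqrt_le_sqrt ?_
  have hd : Integrable (fun ω => |V ω - W ω|) P := ((h2.sub h2').integrable one_le_two).abs
  refine (integral_mono_of_nonneg (.of_forall fun _ => sq_nonneg _)
    (g := fun ω => R * |V ω - W ω| + 8 * R ^ (-δ) * (|V ω| ^ (2 + δ) + |W ω| ^ (2 + δ)))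
    ((hd.const_mul R).add ((hi.fun_add hi').const_mul _))
    (.of_forall fun ω => sq_sub_le hR hδ.le hδ1 _ _)).trans ?_
  rw [integral_add (hd.const_mul R) ((hi.fun_add hi').const_mul _), integral_const_mul,
    integral_const_mul, integral_add hi hi']
  have h0 : 0 ≤ R ^ (-δ) := by positivity
  have h3 := mul_le_mul_of_nonneg_left hτ hR.le
  have h4 := mul_le_mul_of_nonneg_left (add_le_add hK hK') h0
  linarith

end Moments

/-! ### Bookkeeping of geometric rates -/

section Rate

/-- The base of the geometric rate for second moments. -/
def sqRate (ϑ δ : ℝ) : ℝ := √√ϑ ^ δ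

/-- The rate of the `L²`-approximation by local variables. -/
def approxRate (ϑ δ : ℝ) : ℝ := √√(sqRate ϑ δ)

lemma sqrt_mem_Ioo {x : ℝ} (hx : x ∈ Set.Ioo (0 : ℝ) 1) : √x ∈ Set.Ioo (0 : ℝ) 1 :=
  ⟨Real.sqrt_pos.2 hx.1, (Real.sqrt_lt_sqrt hx.1.le hx.2).trans_eq Real.sqrt_one⟩

lemma sqRate_mem {ϑ δ : ℝ} (hϑ : ϑ ∈ Set.Ioo (0 : ℝ) 1) (hδ : 0 < δ) :
    sqRate ϑ δ ∈ Set.Ioo (0 : ℝ) 1 :=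
  have h := sqrt_mem_Ioo (sqrt_mem_Ioo hϑ)
  ⟨Real.rpow_pos_of_pos h.1 _, Real.rpow_lt_one h.1.le h.2 hδ⟩

lemma approxRate_mem {ϑ δ : ℝ} (hϑ : ϑ ∈ Set.Ioo (0 : ℝ) 1) (hδ : 0 < δ) :
    approxRate ϑ δ ∈ Set.Ioo (0 : ℝ) 1 := sqrt_mem_Ioo (sqrt_mem_Ioo (sqRate_mem hϑ hδ))

/-- The fourth root in `approxRate` compensates the outer square root and the exponent `2M` required
by `LocalApprox`. -/
lemma sqrt_mul_sqRate_pow {ϑ δ c : ℝ} (hc : 0 ≤ c) (M : ℕ) :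
    √(c * sqRate ϑ δ ^ M) = √c * approxRate ϑ δ ^ (2 * M) := by
  have h0 : 0 ≤ sqRate ϑ δ := Real.rpow_nonneg (Real.sqrt_nonneg _) _
  rw [Real.sqrt_mul hc, pow_mul, approxRate, Real.sq_sqrt (Real.sqrt_nonneg _)]
  congr 1
  rw [Real.sqrt_eq_iff_mul_self_eq (pow_nonneg h0 _) (pow_nonneg (Real.sqrt_nonneg _) _),
    ← mul_pow, Real.mul_self_sqrt h0]

/-- The level at which variables of locality radius `M` are truncated. -/
def clampLevel (ϑ : ℝ) (M : ℕ) : ℝ := (√√ϑ)⁻¹ ^ M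

lemma clampLevel_pos {ϑ : ℝ} (hϑ : ϑ ∈ Set.Ioo (0 : ℝ) 1) (M : ℕ) : 0 < clampLevel ϑ M :=
  pow_pos (inv_pos.2 (sqrt_mem_Ioo (sqrt_mem_Ioo hϑ)).1) _

lemma clampLevel_rpow {ϑ : ℝ} (δ : ℝ) (M : ℕ) :
    clampLevel ϑ M ^ (-δ) = sqRate ϑ δ ^ M := by
  have h0 : 0 ≤ √√ϑ := Real.sqrt_nonneg _
  rw [clampLevel, sqRate, inv_pow, Real.inv_rpow (pow_nonneg h0 _), Real.rpow_neg (pow_nonneg h0 _),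
    inv_inv, ← Real.rpow_natCast, ← Real.rpow_natCast, ← Real.rpow_mul h0, ← Real.rpow_mul h0,
    mul_comm]

/-- The level `ϑ^(-M/4)` times the `L¹` error rate `ϑ^(M/2)` leaves `ϑ^(M/4)`, which is at most
`ϑ^(δM/4)`. -/
lemma clampLevel_mul_le {ϑ δ : ℝ} (hϑ : ϑ ∈ Set.Ioo (0 : ℝ) 1) (hδ1 : δ ≤ 1) (M : ℕ) :
    clampLevel ϑ M * √ϑ ^ M ≤ sqRate ϑ δ ^ M := by
  have h := sqrt_mem_Ioo (sqrt_mem_Ioo hϑ)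
  have h1 : √ϑ = √√ϑ * √√ϑ := (Real.mul_self_sqrt (Real.sqrt_nonneg _)).symm
  have h2 : (√√ϑ)⁻¹ * √ϑ = √√ϑ := by
    rw [inv_mul_eq_iff_eq_mul₀ h.1.ne']; exact h1
  rw [clampLevel, ← mul_pow, h2]
  refine pow_le_pow_left₀ h.1.le ?_ M
  conv_lhs => rw [← Real.rpow_one √√ϑ]
  exact Real.rpow_le_rpow_of_exponent_ge h.1 h.2.le hδ1

end Rate

/-! ### Local approximation of the array -/

section Arrays

variable {Ω : Type*} {d : ℕ} {ε : ℤ → Ω → Fin d → ℝ} {μ : ℝ → Fin d → ℝ}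
  {A : ℕ → ℤ → ℤ → Matrix (Fin d) (Fin d) ℝ} {Alim : ℝ → ℤ → Matrix (Fin d) (Fin d) ℝ}
  {ϑ B : ℝ} {S : Type*} {f : S → (Fin d → ℝ) → ℝ} {CLip δ : ℝ} {K : ℝ≥0}

lemma lsProcessTrunc_eq (M T : ℕ) (t : ℤ) (ω : Ω) : lsProcessTrunc ε μ A M T t ω
    = μ ((t : ℝ) / (T : ℝ)) + linProc ε (truncCoeff (A T t) M) t ω := by
  rw [linProc_truncCoeff]; rfl

lemma measurable_lsProcessTrunc_local (M T : ℕ) (t : ℤ) :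
    Measurable[innovSigma ε (nbhd t M)] (lsProcessTrunc ε μ A M T t) := by
  refine Measurable.add (@measurable_const _ _ _ (innovSigma ε (nbhd t M)) _) ?_
  refine Finset.measurable_fun_sum _ fun j hj => ?_
  refine (Continuous.matrix_mulVec continuous_const continuous_id).measurable.comp
    (measurable_innov ε ?_)
  rw [Finset.mem_Ioo] at hj
  change |t - j - t| < M
  rw [abs_lt]; omega

/-- The array `f(s, X_{t,T})`, continued by zero outside `1 ≤ t ≤ T`. -/
def lsArray (ε : ℤ → Ω → Fin d → ℝ) (μ : ℝ → Fin d → ℝ)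
    (A : ℕ → ℤ → ℤ → Matrix (Fin d) (Fin d) ℝ) (g : (Fin d → ℝ) → ℝ) (T : ℕ) (t : ℤ) (ω : Ω) : ℝ :=
  if 1 ≤ t ∧ t ≤ T then g (lsProcess ε μ A T t ω) else 0

/-- Bounded local approximations of `lsArray`. -/
def lsArrayLocal (ε : ℤ → Ω → Fin d → ℝ) (μ : ℝ → Fin d → ℝ)
    (A : ℕ → ℤ → ℤ → Matrix (Fin d) (Fin d) ℝ) (ϑ : ℝ) (g : (Fin d → ℝ) → ℝ) (T M : ℕ) (t : ℤ)
    (ω : Ω) : ℝ :=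
  if 1 ≤ M ∧ 1 ≤ t ∧ t ≤ T then clamp (clampLevel ϑ M) (g (lsProcessTrunc ε μ A M T t ω)) else 0

lemma lsArray_of_mem (g : (Fin d → ℝ) → ℝ) {T : ℕ} {t : ℤ} (h : 1 ≤ t ∧ t ≤ T) :
    lsArray ε μ A g T t = fun ω => g (lsProcess ε μ A T t ω) := by
  ext ω; rw [lsArray, if_pos h]

lemma lsArray_of_notMem (g : (Fin d → ℝ) → ℝ) {T : ℕ} {t : ℤ} (h : ¬ (1 ≤ t ∧ t ≤ T)) :
    lsArray ε μ A g T t = fun _ => 0 := by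
  ext ω; rw [lsArray, if_neg h]

lemma lsArrayLocal_of_mem (g : (Fin d → ℝ) → ℝ) {T M : ℕ} {t : ℤ} (h : 1 ≤ M ∧ 1 ≤ t ∧ t ≤ T) :
    lsArrayLocal ε μ A ϑ g T M t
      = fun ω => clamp (clampLevel ϑ M) (g (lsProcessTrunc ε μ A M T t ω)) := by
  ext ω; rw [lsArrayLocal, if_pos h]

lemma lsArrayLocal_of_notMem (g : (Fin d → ℝ) → ℝ) {T M : ℕ} {t : ℤ}
    (h : ¬ (1 ≤ M ∧ 1 ≤ t ∧ t ≤ T)) : lsArrayLocal ε μ A ϑ g T M t = fun _ => 0 := by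
  ext ω; rw [lsArrayLocal, if_neg h]

lemma div_mem_Icc {T : ℕ} {t : ℤ} (h1 : 1 ≤ t) (hT : t ≤ T) :
    (t : ℝ) / T ∈ Set.Icc (0 : ℝ) 1 := by
  have hT0 : (0 : ℝ) < T := by exact_mod_cast h1.trans hT
  exact ⟨div_nonneg (by exact_mod_cast zero_le_one.trans h1) hT0.le,
    (div_le_one hT0).2 (by exact_mod_cast hT)⟩

variable [MeasurableSpace Ω] {P : Measure Ω}

namespace LocallyStationaryLinear

lemma const_nonneg (hX : LocallyStationaryLinear P ε μ A Alim ϑ B) : 0 ≤ B := by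
  simpa using (matNorm1_nonneg _).trans (hX.coeff_bound 1 1 le_rfl (by simp) 0)

lemma sq_sqrt_rate (hX : LocallyStationaryLinear P ε μ A Alim ϑ B) : √ϑ ^ 2 = ϑ :=
  Real.sq_sqrt hX.rate_mem.1.le

lemma pow_rate_le (hX : LocallyStationaryLinear P ε μ A Alim ϑ B) (n : ℕ) : ϑ ^ n ≤ √ϑ ^ n := by
  refine pow_le_pow_left₀ hX.rate_mem.1.le ?_ n
  have h := sqrt_mem_Ioo hX.rate_mem
  calc ϑ = √ϑ ^ 2 := hX.sq_sqrt_rate.symm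
    _ ≤ √ϑ := pow_le_of_le_one h.1.le h.2.le two_ne_zero

/-- The constant `(1 + d) B` is chosen to serve the limit coefficients too, whose entrywise bounds
cost a factor `d`; the comparison of two processes asks for one common constant. -/
lemma matNorm1_coeff_le (hX : LocallyStationaryLinear P ε μ A Alim ϑ B) {T : ℕ} {t : ℤ}
    (h1 : 1 ≤ t) (hT : t ≤ T) (j : ℤ) : matNorm1 (A T t j) ≤ (1 + d) * B * √ϑ ^ j.natAbs := by
  refine (hX.coeff_bound T t h1 hT j).trans (mul_le_mul ?_ (hX.pow_rate_le _)
    (pow_nonneg hX.rate_mem.1.le _) (mul_nonneg (by positivity) hX.const_nonneg))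
  have := hX.const_nonneg
  nlinarith [mul_nonneg (Nat.cast_nonneg (α := ℝ) d) this]

lemma matNorm1_lim_le (hX : LocallyStationaryLinear P ε μ A Alim ϑ B) {u : ℝ}
    (hu : u ∈ Set.Icc (0 : ℝ) 1) (j : ℤ) :
    matNorm1 (Alim u j) ≤ (1 + d) * B * √ϑ ^ j.natAbs := by
  have hB := hX.const_nonneg
  have h1 : 0 ≤ B * ϑ ^ j.natAbs := mul_nonneg hB (pow_nonneg hX.rate_mem.1.le _)
  refine (matNorm1_le h1 fun p q => hX.lim_bound j p q u hu).trans ?_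
  have h2 := mul_le_mul_of_nonneg_left (hX.pow_rate_le j.natAbs) hB
  have h3 : 0 ≤ B * √ϑ ^ j.natAbs := mul_nonneg hB (pow_nonneg (Real.sqrt_nonneg _) _)
  have h4 := mul_le_mul_of_nonneg_left h2 (Nat.cast_nonneg (α := ℝ) d)
  nlinarith

lemma matNorm1_lim_sub_le (hX : LocallyStationaryLinear P ε μ A Alim ϑ B) {u v : ℝ}
    (hu : u ∈ Set.Icc (0 : ℝ) 1) (hv : v ∈ Set.Icc (0 : ℝ) 1) (j : ℤ) :
    matNorm1 (Alim u j - Alim v j) ≤ d * (B * |u - v|) * √ϑ ^ j.natAbs := by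
  have hB := hX.const_nonneg
  have h0 : 0 ≤ ϑ ^ j.natAbs := pow_nonneg hX.rate_mem.1.le _
  have h1 : ∀ p q, |(Alim u j - Alim v j) p q| ≤ B * ϑ ^ j.natAbs * |u - v| := fun p q =>
    Convex.norm_image_sub_le_of_norm_derivWithin_le (f := fun v => Alim v j p q)
      ((hX.contDiffOn_lim j p q).differentiableOn one_ne_zero)
      (fun z hz => hX.deriv_lim_bound j p q z hz) (convex_Icc 0 1) hv hu
  refine (matNorm1_le (mul_nonneg (mul_nonneg hB h0) (abs_nonneg _)) h1).trans ?_
  have h2 := mul_le_mul_of_nonneg_left (hX.pow_rate_le j.natAbs)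
    (mul_nonneg (Nat.cast_nonneg (α := ℝ) d) (mul_nonneg hB (abs_nonneg (u - v))))
  linarith

lemma exists_mean_lipschitz (hX : LocallyStationaryLinear P ε μ A Alim ϑ B) :
    ∃ L : ℝ, 0 ≤ L ∧ ∀ u ∈ Set.Icc (0 : ℝ) 1, ∀ v ∈ Set.Icc (0 : ℝ) 1,
      vecNorm1 (μ u - μ v) ≤ L * |u - v| := by
  choose k hk using fun p => (hX.contDiffOn_mean p).exists_lipschitzOnWith one_ne_zero
    (convex_Icc (0 : ℝ) 1) isCompact_Icc
  refine ⟨∑ p, (k p : ℝ), Finset.sum_nonneg fun p _ => (k p).2, fun u hu v hv => ?_⟩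
  rw [vecNorm1, Finset.sum_mul]
  refine Finset.sum_le_sum fun p _ => ?_
  have := (hk p).dist_le_mul u hu v hv
  rwa [Real.dist_eq, Real.dist_eq] at this

lemma matNorm1_coeff_sub_lim_le (hX : LocallyStationaryLinear P ε μ A Alim ϑ B) {T : ℕ} {t : ℤ}
    (h1 : 1 ≤ t) (hT : t ≤ T) {u : ℝ} (hu : u ∈ Set.Icc (0 : ℝ) 1) (j : ℤ) :
    matNorm1 (A T t j - Alim u j)
      ≤ (B / T + d * (B * |(t : ℝ) / T - u|)) * √ϑ ^ j.natAbs := by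
  have hT0 : (0 : ℝ) < T := by exact_mod_cast h1.trans hT
  have h2 := hX.matNorm1_lim_sub_le (div_mem_Icc h1 hT) hu j
  have h3 : matNorm1 (A T t j - Alim ((t : ℝ) / T) j) ≤ B / T * √ϑ ^ j.natAbs := by
    rw [div_mul_eq_mul_div, le_div_iff₀ hT0, mul_comm]
    exact (hX.coeff_approx T t h1 hT j).trans
      (mul_le_mul_of_nonneg_left (hX.pow_rate_le _) hX.const_nonneg)
  have h4 := matNorm1_add_le (A T t j - Alim ((t : ℝ) / T) j) (Alim ((t : ℝ) / T) j - Alim u j)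
  rw [sub_add_sub_cancel] at h4
  linarith

end LocallyStationaryLinear

lemma measurable_lsProcess (hX : LocallyStationaryLinear P ε μ A Alim ϑ B) (T : ℕ) (t : ℤ) :
    Measurable (lsProcess ε μ A T t) :=
  measurable_const.add (measurable_linProc hX.measurable_innov (A T t) t)

lemma measurable_companion (hX : LocallyStationaryLinear P ε μ A Alim ϑ B) (u : ℝ) (t : ℤ) :
    Measurable (companion ε μ Alim u t) :=
  measurable_const.add (measurable_linProc hX.measurable_innov (Alim u) t)

namespace AdmissibleFunction

lemma measurable (hf : AdmissibleFunction P ε μ A Alim f CLip δ K) (s : S) : Measurable (f s) :=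
  (continuous_of_vecNorm1_lipschitz (hf.lipschitz s)).measurable

lemma lintegral_ls_le (hf : AdmissibleFunction P ε μ A Alim f CLip δ K) {T : ℕ} {t : ℤ}
    (h1 : 1 ≤ t) (hT : t ≤ T) (s : S) :
    ∫⁻ ω, ‖f s (lsProcess ε μ A T t ω)‖ₑ ^ (2 + δ) ∂P ≤ K :=
  (lintegral_mono fun _ => le_self_add).trans (hf.moment T t h1 hT s 1 le_rfl)

lemma lintegral_trunc_le (hf : AdmissibleFunction P ε μ A Alim f CLip δ K) {T : ℕ} {t : ℤ}
    (h1 : 1 ≤ t) (hT : t ≤ T) (s : S) {M : ℕ} (hM : 1 ≤ M) :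
    ∫⁻ ω, ‖f s (lsProcessTrunc ε μ A M T t ω)‖ₑ ^ (2 + δ) ∂P ≤ K :=
  (lintegral_mono fun _ => le_add_self).trans (hf.moment T t h1 hT s M hM)

lemma lintegral_companion_le (hf : AdmissibleFunction P ε μ A Alim f CLip δ K) {u : ℝ}
    (hu : u ∈ Set.Icc (0 : ℝ) 1) (s : S) :
    ∫⁻ ω, ‖f s (companion ε μ Alim u 0 ω)‖ₑ ^ (2 + δ) ∂P ≤ K :=
  (lintegral_mono fun _ => le_self_add).trans (hf.moment_companion u hu s 1 le_rfl)

end AdmissibleFunction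

/-- The constant in the `L²`-approximation of `lsArray`. -/
def approxConst (P : Measure Ω) (ε : ℤ → Ω → Fin d → ℝ) (ϑ B CLip : ℝ) (K : ℝ≥0) : ℝ :=
  √(|CLip| * (B * ((∑' j : ℤ, √ϑ ^ j.natAbs) * ∫ ω, vecNorm1 (ε 1 ω) ∂P)) + 16 * K)
    + √(K : ℝ) + √(1 + K)

theorem localApprox_lsArray [IsProbabilityMeasure P]
    (hX : LocallyStationaryLinear P ε μ A Alim ϑ B)
    (hf : AdmissibleFunction P ε μ A Alim f CLip δ K) (s : S) (T : ℕ) :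
    LocalApprox P ε (lsArray ε μ A (f s) T) (lsArrayLocal ε μ A ϑ (f s) T) (clampLevel ϑ)
      (approxConst P ε ϑ B CLip K) (approxRate ϑ δ) := by
  have hδ0 := hf.delta_mem.1
  have hδ1 : δ ≤ 1 := by linarith [hf.delta_mem.2]
  have hr := sqrt_mem_Ioo hX.rate_mem
  have hB := hX.const_nonneg
  have hfm := hf.measurable s
  set τ : ℝ := |CLip| * (B * ((∑' j : ℤ, √ϑ ^ j.natAbs) * ∫ ω, vecNorm1 (ε 1 ω) ∂P)) with hτ
  have hτ0 : 0 ≤ τ := mul_nonneg (abs_nonneg _) (mul_nonneg hB (mul_nonneg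
    (tsum_nonneg fun _ => pow_nonneg hr.1.le _) (integral_nonneg fun _ => vecNorm1_nonneg _)))
  have hK0 : (0 : ℝ) ≤ K := K.2
  have htm : ∀ (M : ℕ) t, Measurable (lsProcessTrunc ε μ A M T t) := fun M t =>
    (measurable_lsProcessTrunc_local M T t).mono (innovSigma_le hX.measurable_innov _) le_rfl
  refine ⟨fun t => ?_, fun M t => ?_, fun M t ω => ?_, fun M t => ?_, fun t ω => ?_⟩
  · by_cases h : 1 ≤ t ∧ t ≤ T
    · rw [lsArray_of_mem _ h]
      exact (moment_facts (hfm.comp (measurable_lsProcess hX T t)) hδ0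
        (hf.lintegral_ls_le h.1 h.2 s)).1
    · rw [lsArray_of_notMem _ h]; exact memLp_const 0
  · by_cases h : 1 ≤ M ∧ 1 ≤ t ∧ t ≤ T
    · rw [lsArrayLocal_of_mem _ h]
      exact (measurable_clamp _).comp (hfm.comp (measurable_lsProcessTrunc_local M T t))
    · rw [lsArrayLocal_of_notMem _ h]
      exact @measurable_const _ _ _ (innovSigma ε (nbhd t M)) _
  · have hp := (clampLevel_pos hX.rate_mem M).le
    unfold lsArrayLocal
    split_ifs
    · exact abs_clamp_le hp _
    · simpa using hp
  · by_cases h : 1 ≤ t ∧ t ≤ T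
    · by_cases hM : 1 ≤ M
      · have h' : 1 ≤ M ∧ 1 ≤ t ∧ t ≤ T := ⟨hM, h⟩
        simp only [lsArray_of_mem _ h, lsArrayLocal_of_mem _ h']
        have hR := clampLevel_pos hX.rate_mem M
        have hV : Measurable fun ω => f s (lsProcess ε μ A T t ω) :=
          hfm.comp (measurable_lsProcess hX T t)
        have hW : Measurable fun ω => f s (lsProcessTrunc ε μ A M T t ω) := hfm.comp (htm M t)
        have hVK := hf.lintegral_ls_le h.1 h.2 s
        have hWK := hf.lintegral_trunc_le h.1 h.2 s hM
        have h1 : ∫ ω, |f s (lsProcess ε μ A T t ω) - f s (lsProcessTrunc ε μ A M T t ω)| ∂P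
            ≤ τ * √ϑ ^ M := by
          simp only [lsProcessTrunc_eq]
          refine (integral_abs_lipschitz_linProc_sub_le hX.identDistrib_innov
            hX.integrable_innov hr (hX.matNorm1_coeff_le h.1 h.2)
            (matNorm1_truncCoeff_le (hX.matNorm1_coeff_le h.1 h.2) M)
            (matNorm1_sub_truncCoeff_le hB hr (fun j => by
              rw [hX.sq_sqrt_rate]; exact hX.coeff_bound T t h.1 h.2 j) M)
            (hf.lipschitz s) _ _ t).trans_eq ?_
          rw [sub_self, vecNorm1_zero, hτ]; ring
        have h2 := l2_sub_le_of_moment hV hW hδ0 hδ1 hVK hWK h1 hR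
        have h3 := l2_sub_clamp_le hW hδ0 hWK hR
        have hVL := (moment_facts hV hδ0 hVK).1
        have hWL := (moment_facts hW hδ0 hWK).1
        have hcL : MemLp (fun ω => clamp (clampLevel ϑ M) (f s (lsProcessTrunc ε μ A M T t ω)))
            2 P := MemLp.of_bound ((measurable_clamp _).comp hW).aestronglyMeasurable
              (clampLevel ϑ M) (.of_forall fun ω => abs_clamp_le hR.le _)
        -- The intermediate point is the unclamped `f s` of the truncated process: one error from
        -- the filter, one from the clamp.
        have h4 := l2_add_le (hVL.sub hWL) (hWL.sub hcL)
        simp only [Pi.sub_apply, sub_add_sub_cancel] at h4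
        refine h4.trans ((add_le_add h2 h3).trans ?_)
        have h5 : clampLevel ϑ M * (τ * √ϑ ^ M) + 16 * K * clampLevel ϑ M ^ (-δ)
            ≤ (τ + 16 * K) * sqRate ϑ δ ^ M := by
          have := mul_le_mul_of_nonneg_left (clampLevel_mul_le hX.rate_mem hδ1 M) hτ0
          rw [clampLevel_rpow]
          linarith
        refine (add_le_add (Real.sqrt_le_sqrt h5) le_rfl).trans ?_
        rw [clampLevel_rpow, sqrt_mul_sqRate_pow (by positivity), sqrt_mul_sqRate_pow hK0,
          ← add_mul]
        refine mul_le_mul_of_nonneg_right ?_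
          (pow_nonneg (approxRate_mem hX.rate_mem hδ0).1.le _)
        exact le_add_of_nonneg_right (Real.sqrt_nonneg _)
      · have h' : ¬ (1 ≤ M ∧ 1 ≤ t ∧ t ≤ T) := fun h' => hM h'.1
        simp only [lsArray_of_mem _ h, lsArrayLocal_of_notMem _ h', sub_zero]
        -- Radius `0` has approximant `0`, so the plain `L²` norm must be bounded; this is the
        -- summand `√(1 + K)` of `approxConst`.
        rw [show M = 0 by omega, mul_zero, pow_zero, mul_one]
        refine (l2_le_of_moment (hfm.comp (measurable_lsProcess hX T t)) hδ0
          (hf.lintegral_ls_le h.1 h.2 s)).trans ?_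
        exact le_add_of_nonneg_left (by positivity)
    · have h' : ¬ (1 ≤ M ∧ 1 ≤ t ∧ t ≤ T) := fun h' => h h'.2
      simp only [lsArray_of_notMem _ h, lsArrayLocal_of_notMem _ h', sub_self]
      have : l2 P (fun _ : Ω => (0 : ℝ)) = 0 := by simp [l2]
      rw [this]
      have := (approxRate_mem hX.rate_mem hδ0).1.le
      unfold approxConst
      positivity
  · simp [lsArrayLocal]

end Arrays

/-! ### Stationarity of the companion process -/

section Stationarity

variable {Ω : Type*} {d : ℕ} {ε : ℤ → Ω → Fin d → ℝ} {μ : ℝ → Fin d → ℝ}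
  {Alim : ℝ → ℤ → Matrix (Fin d) (Fin d) ℝ}

/-- A time shift is the same functional evaluated on shifted noise, so stationarity reduces to shift
invariance of an i.i.d. product law. -/
lemma companion_add (u : ℝ) (h t : ℤ) (ω : Ω) :
    companion ε μ Alim u (h + t) ω
      = companion (fun j (e : ℤ → Fin d → ℝ) => e j) μ Alim u h (fun j => ε (j + t) ω) := by
  unfold companion
  congr 2
  ext j
  rw [add_sub_right_comm]

variable [MeasurableSpace Ω] {P : Measure Ω}
  {A : ℕ → ℤ → ℤ → Matrix (Fin d) (Fin d) ℝ} {ϑ B : ℝ}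

lemma measurable_companion_eval (u : ℝ) (h : ℤ) :
    Measurable (companion (fun j (e : ℤ → Fin d → ℝ) => e j) μ Alim u h) :=
  measurable_const.add (measurable_linProc (fun t => measurable_pi_apply t) (Alim u) h)

lemma map_shift_innov [IsProbabilityMeasure P]
    (hX : LocallyStationaryLinear P ε μ A Alim ϑ B) (t : ℤ) :
    P.map (fun ω j => ε (j + t) ω) = P.map (fun ω j => ε j ω) := by
  rw [iIndepFun.map_fun_eq_infinitePi_map (X := fun j => ε (j + t))
      (fun j => hX.measurable_innov _) (hX.indep_innov.precomp (add_left_injective t)),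
    iIndepFun.map_fun_eq_infinitePi_map hX.measurable_innov hX.indep_innov]
  congr 1
  ext1 j
  rw [(hX.identDistrib_innov (j + t)).map_eq, (hX.identDistrib_innov j).map_eq]

/-- The lag covariances are defined at times `0` and `h`, while the array is observed at `t` and `t
+ h`. -/
lemma cov_companion_shift [IsProbabilityMeasure P]
    (hX : LocallyStationaryLinear P ε μ A Alim ϑ B) {g g' : (Fin d → ℝ) → ℝ} (hg : Measurable g)
    (hg' : Measurable g') (u : ℝ) (h t : ℤ) :
    cov[fun ω => g (companion ε μ Alim u t ω), fun ω => g' (companion ε μ Alim u (h + t) ω); P]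
      = cov[fun ω => g (companion ε μ Alim u 0 ω), fun ω => g' (companion ε μ Alim u h ω); P] := by
  have key : ∀ t : ℤ, cov[fun ω => g (companion ε μ Alim u (0 + t) ω),
      fun ω => g' (companion ε μ Alim u (h + t) ω); P]
      = cov[fun e => g (companion (fun j (e : ℤ → Fin d → ℝ) => e j) μ Alim u 0 e),
        fun e => g' (companion (fun j (e : ℤ → Fin d → ℝ) => e j) μ Alim u h e);
        P.map (fun ω j => ε j ω)] := fun t => by
    rw [← map_shift_innov hX t]
    simp only [companion_add]
    exact (covariance_map_fun
      (hg.comp (measurable_companion_eval u 0)).aestronglyMeasurable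
      (hg'.comp (measurable_companion_eval u h)).aestronglyMeasurable
      (measurable_pi_lambda _ fun j => hX.measurable_innov _).aemeasurable).symm
  have h1 := (key t).trans (key 0).symm
  simpa using h1

lemma lintegral_companion_shift [IsProbabilityMeasure P]
    (hX : LocallyStationaryLinear P ε μ A Alim ϑ B) {g : (Fin d → ℝ) → ℝ≥0∞} (hg : Measurable g)
    (u : ℝ) (t : ℤ) :
    ∫⁻ ω, g (companion ε μ Alim u t ω) ∂P = ∫⁻ ω, g (companion ε μ Alim u 0 ω) ∂P := by
  have key : ∀ t : ℤ, ∫⁻ ω, g (companion ε μ Alim u (0 + t) ω) ∂P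
      = ∫⁻ e, g (companion (fun j (e : ℤ → Fin d → ℝ) => e j) μ Alim u 0 e)
        ∂(P.map (fun ω j => ε j ω)) := fun t => by
    rw [← map_shift_innov hX t]
    simp only [companion_add]
    exact (lintegral_map (hg.comp (measurable_companion_eval u 0))
      (measurable_pi_lambda _ fun j => hX.measurable_innov _)).symm
  have h1 := (key t).trans (key 0).symm
  simpa using h1

end Stationarity

/-! ### Weighted sums at a fixed lag -/

section Weights

variable {w : ℕ → ℤ → ℝ} {Cw : ℝ}

lemma card_shift_out_le (T : ℕ) (h : ℤ) :
    ((Finset.Icc (1 : ℤ) T).filter fun t => ¬ (1 ≤ t + h ∧ t + h ≤ T)).card ≤ h.natAbs := by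
  rcases le_total 0 h with h0 | h0
  · refine (Finset.card_le_card (t := Finset.Ioc ((T : ℤ) - h) T) fun t ht => ?_).trans ?_
    · simp only [Finset.mem_filter, Finset.mem_Icc, Finset.mem_Ioc] at ht ⊢
      omega
    · rw [Int.card_Ioc]; omega
  · refine (Finset.card_le_card (t := Finset.Ico (1 : ℤ) (1 - h)) fun t ht => ?_).trans ?_
    · simp only [Finset.mem_filter, Finset.mem_Icc, Finset.mem_Ico] at ht ⊢
      omega
    · rw [Int.card_Ico]; omega

lemma extWeight_of_mem {T : ℕ} {t : ℤ} (h1 : 1 ≤ t) (hT : t ≤ T) : extWeight w T t = w T t := by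
  rw [extWeight, min_eq_left hT, max_eq_right h1]

/-- There are `d_T` nonzero terms and each product of weights is at most `Cw²/d_T`, so `G` is merely
averaged. The penalty `G'` is paid only at the at most `|h|` indices whose shift leaves the window.
-/
lemma abs_lag_sum_le (hw : AdmissibleWeights w Cw) {T : ℕ} (hn : 0 < numNonzero w T) (h : ℤ)
    {g : ℤ → ℝ} {G G' : ℝ} (hG' : 0 ≤ G')
    (hg : ∀ t : ℤ, 1 ≤ t → t ≤ T → |g t| ≤ G + if 1 ≤ t + h ∧ t + h ≤ T then 0 else G') :
    |∑ t ∈ Finset.Icc (1 : ℤ) T, w T t * extWeight w T (t + h) * g t|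
      ≤ Cw ^ 2 * (G + h.natAbs * G' / numNonzero w T) := by
  classical
  set n : ℝ := (numNonzero w T : ℝ) with hndef
  have hn0 : 0 < n := Nat.cast_pos.2 hn
  have hT1 : (1 : ℤ) ≤ T := by
    obtain ⟨t, ht⟩ := Finset.card_pos.1 hn
    have := Finset.mem_Icc.1 (Finset.mem_filter.1 ht).1
    omega
  have hcard : (((Finset.Icc (1 : ℤ) T).filter fun t => w T t ≠ 0).card : ℝ) = n := by
    rw [hndef, numNonzero]
  set F := (Finset.Icc (1 : ℤ) T).filter fun t => w T t ≠ 0 with hF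
  have hout : ∑ t ∈ F, (if 1 ≤ t + h ∧ t + h ≤ T then 0 else G') ≤ h.natAbs * G' := by
    refine (Finset.sum_le_sum_of_subset_of_nonneg (Finset.filter_subset _ _)
      fun t _ _ => by split_ifs <;> simp [hG']).trans ?_
    have e : ∀ t ∈ Finset.Icc (1 : ℤ) T, (if 1 ≤ t + h ∧ t + h ≤ T then 0 else G')
        = if ¬ (1 ≤ t + h ∧ t + h ≤ T) then G' else 0 := fun t _ => by split_ifs <;> rfl
    rw [Finset.sum_congr rfl e, ← Finset.sum_filter, Finset.sum_const, nsmul_eq_mul]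
    exact mul_le_mul_of_nonneg_right (by exact_mod_cast card_shift_out_le T h) hG'
  have hsum : ∑ t ∈ Finset.Icc (1 : ℤ) T, w T t * extWeight w T (t + h) * g t
      = ∑ t ∈ F, w T t * extWeight w T (t + h) * g t := by
    refine (Finset.sum_subset (Finset.filter_subset _ _) fun t ht ht' => ?_).symm
    have : w T t = 0 := by
      by_contra h0
      exact ht' (Finset.mem_filter.2 ⟨ht, h0⟩)
    rw [this, zero_mul, zero_mul]
  rw [hsum]
  have hterm : ∀ t ∈ F, |w T t * extWeight w T (t + h) * g t|
      ≤ Cw ^ 2 / n * (G + if 1 ≤ t + h ∧ t + h ≤ T then 0 else G') := fun t ht => by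
    have ht := Finset.mem_Icc.1 (Finset.mem_filter.1 ht).1
    have h1 : 1 ≤ max 1 (min (t + h) (T : ℤ)) := le_max_left _ _
    have h2 : max 1 (min (t + h) (T : ℤ)) ≤ T := max_le hT1 (min_le_right _ _)
    have hw1 := hw.nonneg T t ht.1 ht.2
    have hw2 : 0 ≤ extWeight w T (t + h) := hw.nonneg T _ h1 h2
    rw [abs_mul, abs_of_nonneg (mul_nonneg hw1 hw2)]
    refine mul_le_mul ?_ (hg t ht.1 ht.2) (abs_nonneg _) (by positivity)
    refine (mul_le_mul (hw.bound T t ht.1 ht.2) (hw.bound T _ h1 h2) hw2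
      (hw1.trans (hw.bound T t ht.1 ht.2))).trans_eq ?_
    rw [div_mul_div_comm, Real.mul_self_sqrt hn0.le, sq]
  refine (Finset.abs_sum_le_sum_abs _ _).trans ((Finset.sum_le_sum hterm).trans ?_)
  rw [← Finset.mul_sum, Finset.sum_add_distrib, Finset.sum_const, nsmul_eq_mul, hcard]
  calc Cw ^ 2 / n * (n * G + _) ≤ Cw ^ 2 / n * (n * G + h.natAbs * G') := by gcongr
    _ = _ := by field_simp

lemma tendsto_numNonzero_real (hw : AdmissibleWeights w Cw) :
    Tendsto (fun T => (numNonzero w T : ℝ)) atTop atTop :=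
  tendsto_natCast_atTop_atTop.comp hw.tendsto_numNonzero

lemma eventually_numNonzero_pos (hw : AdmissibleWeights w Cw) :
    ∀ᶠ T in atTop, 0 < numNonzero w T := hw.tendsto_numNonzero.eventually_gt_atTop 0

end Weights

/-! ### Convergence of the covariances -/

section LagCovariances

variable {Ω : Type*} [MeasurableSpace Ω] {P : Measure Ω} [IsProbabilityMeasure P] {d : ℕ}
  {ε : ℤ → Ω → Fin d → ℝ} {μ : ℝ → Fin d → ℝ}
  {A : ℕ → ℤ → ℤ → Matrix (Fin d) (Fin d) ℝ} {Alim : ℝ → ℤ → Matrix (Fin d) (Fin d) ℝ}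
  {ϑ B : ℝ} {S : Type*} {f : S → (Fin d → ℝ) → ℝ} {CLip δ : ℝ} {K : ℝ≥0}
  {w : ℕ → ℤ → ℝ} {Cw : ℝ}

lemma lintegral_companion_le_of_shift (hX : LocallyStationaryLinear P ε μ A Alim ϑ B)
    (hf : AdmissibleFunction P ε μ A Alim f CLip δ K) {u : ℝ}
    (hu : u ∈ Set.Icc (0 : ℝ) 1) (s : S) (t : ℤ) :
    ∫⁻ ω, ‖f s (companion ε μ Alim u t ω)‖ₑ ^ (2 + δ) ∂P ≤ K := by
  rw [lintegral_companion_shift hX (g := fun x => ‖f s x‖ₑ ^ (2 + δ))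
    ((hf.measurable s).enorm.pow_const _) u t]
  exact hf.lintegral_companion_le hu s

/-- The `L²`-distance of `f(s, X_{t,T})` and `f(s, X̃_t(u))` for `|t/T - u| ≤ l/T`. -/
lemma exists_l2_ls_sub_companion_le (hX : LocallyStationaryLinear P ε μ A Alim ϑ B)
    (hf : AdmissibleFunction P ε μ A Alim f CLip δ K) (l : ℕ) :
    ∃ ψ : ℕ → ℝ, Tendsto ψ atTop (𝓝 0) ∧ ∀ (T : ℕ) (t : ℤ), 1 ≤ t → t ≤ T →
      ∀ u ∈ Set.Icc (0 : ℝ) 1, |(t : ℝ) / T - u| ≤ l / T → ∀ s : S,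
      l2 P (fun ω => f s (lsProcess ε μ A T t ω) - f s (companion ε μ Alim u t ω)) ≤ ψ T := by
  obtain ⟨L, hL0, hL⟩ := hX.exists_mean_lipschitz
  have hδ0 := hf.delta_mem.1
  have hδ1 : δ ≤ 1 := by linarith [hf.delta_mem.2]
  have hB := hX.const_nonneg
  have hr := sqrt_mem_Ioo hX.rate_mem
  set E : ℝ := (∑' j : ℤ, √ϑ ^ j.natAbs) * ∫ ω, vecNorm1 (ε 1 ω) ∂P with hE
  have hE0 : 0 ≤ E := mul_nonneg (tsum_nonneg fun _ => pow_nonneg hr.1.le _)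
    (integral_nonneg fun _ => vecNorm1_nonneg _)
  set c : ℝ := |CLip| * (L * l + (B + d * (B * l)) * E) with hc
  -- Level `R = √T`: the `L¹` distance is at most `c/T`, so `R · c/T` and `R^(-δ)` both tend to
  -- zero.
  refine ⟨fun T => √(√(T : ℝ) * (c / T) + 16 * K * √(T : ℝ) ^ (-δ)), ?_, ?_⟩
  · have h1 : Tendsto (fun T : ℕ => √(T : ℝ)) atTop atTop :=
      Real.tendsto_sqrt_atTop.comp tendsto_natCast_atTop_atTop
    have h2 : Tendsto (fun T : ℕ => √(T : ℝ) * (c / T)) atTop (𝓝 0) := by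
      have h3 : (fun T : ℕ => √(T : ℝ) * (c / T)) = fun T : ℕ => c * (√(T : ℝ))⁻¹ := by
        ext T
        rcases Nat.eq_zero_or_pos T with h0 | h0
        · simp [h0]
        have h4 : (0 : ℝ) < T := by exact_mod_cast h0
        have h5 : √(T : ℝ) * √(T : ℝ) = T := Real.mul_self_sqrt h4.le
        have h6 : √(T : ℝ) ≠ 0 := (Real.sqrt_pos.2 h4).ne'
        rw [← div_eq_mul_inv, mul_div_assoc', div_eq_div_iff h4.ne' h6]
        linear_combination c * h5
      rw [h3]
      simpa using (tendsto_inv_atTop_zero.comp h1).const_mul c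
    have h3 : Tendsto (fun T : ℕ => √(T : ℝ) ^ (-δ)) atTop (𝓝 0) :=
      (tendsto_rpow_neg_atTop hδ0).comp h1
    simpa using (h2.add (h3.const_mul (16 * (K : ℝ)))).sqrt
  · intro T t h1 hT u hu htu s
    have hT0 : (0 : ℝ) < T := by exact_mod_cast h1.trans hT
    refine l2_sub_le_of_moment ((hf.measurable s).comp (measurable_lsProcess hX T t))
      ((hf.measurable s).comp (measurable_companion hX u t)) hδ0 hδ1
      (hf.lintegral_ls_le h1 hT s) (lintegral_companion_le_of_shift hX hf hu s t) ?_
      (Real.sqrt_pos.2 hT0)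
    refine (integral_abs_lipschitz_linProc_sub_le hX.identDistrib_innov hX.integrable_innov hr
      (hX.matNorm1_coeff_le h1 hT) (hX.matNorm1_lim_le hu)
      (hX.matNorm1_coeff_sub_lim_le h1 hT hu) (hf.lipschitz s) _ _ t).trans ?_
    rw [← hE]
    have h2 : vecNorm1 (μ ((t : ℝ) / T) - μ u) ≤ L * (l / T) :=
      (hL _ (div_mem_Icc h1 hT) u hu).trans (mul_le_mul_of_nonneg_left htu hL0)
    have h3 : (B / T + d * (B * |(t : ℝ) / T - u|)) * E ≤ (B / T + d * (B * (l / T))) * E := by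
      gcongr
    refine (mul_le_mul_of_nonneg_left (add_le_add h2 h3) (abs_nonneg _)).trans_eq ?_
    rw [hc]; field_simp

/-- The covariance at lag `h` of the weighted array. -/
def lagCovLs (P : Measure Ω) (ε : ℤ → Ω → Fin d → ℝ) (μ : ℝ → Fin d → ℝ)
    (A : ℕ → ℤ → ℤ → Matrix (Fin d) (Fin d) ℝ) (w : ℕ → ℤ → ℝ) (g g' : (Fin d → ℝ) → ℝ) (h : ℤ)
    (T : ℕ) : ℝ :=
  ∑ t ∈ Finset.Icc (1 : ℤ) (T : ℤ), w T t * extWeight w T (t + h) *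
    cov[lsArray ε μ A g T t, lsArray ε μ A g' T (t + h); P]

/-- This is the summable majorant over lags, uniform in `T`, for dominated convergence. -/
lemma abs_lagCovLs_le (hX : LocallyStationaryLinear P ε μ A Alim ϑ B)
    (hf : AdmissibleFunction P ε μ A Alim f CLip δ K) (hw : AdmissibleWeights w Cw) (s s' : S)
    (h : ℤ) {T : ℕ} (hn : 0 < numNonzero w T) :
    |lagCovLs P ε μ A w (f s) (f s') h T|
      ≤ Cw ^ 2 * (3 * approxConst P ε ϑ B CLip K ^ 2) * approxRate ϑ δ ^ gap h := by
  refine (abs_lag_sum_le hw hn h le_rfl (G := 3 * approxConst P ε ϑ B CLip K ^ 2 *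
    approxRate ϑ δ ^ gap h) fun t _ _ => ?_).trans_eq (by simp; ring)
  have := LocalApprox.abs_cov_le hX.measurable_innov hX.indep_innov
    (approxRate_mem hX.rate_mem hf.delta_mem.1) (localApprox_lsArray hX hf s T)
    (localApprox_lsArray hX hf s' T) t (t + h)
  rw [add_sub_cancel_left] at this
  simpa using this

/-- Inside the window both factors are compared with the companion frozen at `t/T`; at time `t + h`
the rescaled time is off by `|h|/T`. Outside, the array is zero and the companion covariance is
bounded, which costs only `|h|/d_T`. -/
lemma tendsto_lagCovLs_sub_lagCov (hX : LocallyStationaryLinear P ε μ A Alim ϑ B)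
    (hf : AdmissibleFunction P ε μ A Alim f CLip δ K) (hw : AdmissibleWeights w Cw) (s s' : S)
    (h : ℤ) :
    Tendsto (fun T => lagCovLs P ε μ A w (f s) (f s') h T - lagCov P ε μ Alim w f s s' h T)
      atTop (𝓝 0) := by
  obtain ⟨ψ, hψ, hψl⟩ := exists_l2_ls_sub_companion_le hX hf h.natAbs
  have hδ0 := hf.delta_mem.1
  have hmain : ∀ T, 0 < numNonzero w T →
      |lagCovLs P ε μ A w (f s) (f s') h T - lagCov P ε μ Alim w f s s' h T|
      ≤ Cw ^ 2 * (|ψ T| * (2 * √(1 + K))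
        + h.natAbs * (√(1 + K) * √(1 + K)) / numNonzero w T) := by
    intro T hn
    have e : lagCovLs P ε μ A w (f s) (f s') h T - lagCov P ε μ Alim w f s s' h T
        = ∑ t ∈ Finset.Icc (1 : ℤ) (T : ℤ), w T t * extWeight w T (t + h) *
          (cov[lsArray ε μ A (f s) T t, lsArray ε μ A (f s') T (t + h); P]
          - cov[fun ω => f s (companion ε μ Alim ((t : ℝ) / (T : ℝ)) 0 ω),
            fun ω => f s' (companion ε μ Alim ((t : ℝ) / (T : ℝ)) h ω); P]) := by
      rw [lagCovLs, lagCov, ← Finset.sum_sub_distrib]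
      exact Finset.sum_congr rfl fun t _ => by ring
    rw [e]
    refine abs_lag_sum_le hw hn h (by positivity) fun t h1 hT => ?_
    have hu := div_mem_Icc h1 hT
    have hT0 : (0 : ℝ) < T := by exact_mod_cast h1.trans hT
    set u : ℝ := (t : ℝ) / T with hudef
    rw [← cov_companion_shift hX (hf.measurable s) (hf.measurable s') u h t, add_comm h t]
    have hmc : ∀ (s : S) (r : ℤ), Measurable fun ω => f s (companion ε μ Alim u r ω) := fun s r =>
      (hf.measurable s).comp (measurable_companion hX u r)
    have hcK := fun (s : S) (r : ℤ) => lintegral_companion_le_of_shift hX hf hu s r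
    have hcL := fun (s : S) (r : ℤ) => (moment_facts (hmc s r) hδ0 (hcK s r)).1
    have hcl := fun (s : S) (r : ℤ) => l2_le_of_moment (hmc s r) hδ0 (hcK s r)
    split_ifs with hth
    · rw [lsArray_of_mem _ ⟨h1, hT⟩, lsArray_of_mem _ hth, add_zero]
      have hml : ∀ (s : S) (r : ℤ), Measurable fun ω => f s (lsProcess ε μ A T r ω) := fun s r =>
        (hf.measurable s).comp (measurable_lsProcess hX T r)
      have hV := (moment_facts (hml s t) hδ0 (hf.lintegral_ls_le h1 hT s)).1
      have hW := (moment_facts (hml s' (t + h)) hδ0 (hf.lintegral_ls_le hth.1 hth.2 s')).1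
      have hWl := l2_le_of_moment (hml s' (t + h)) hδ0 (hf.lintegral_ls_le hth.1 hth.2 s')
      refine (abs_cov_sub_cov_le hV hW (hcL s t) (hcL s' (t + h))).trans ?_
      have h2 := (hψl T t h1 hT u hu (by rw [hudef, sub_self, abs_zero]; positivity) s).trans
        (le_abs_self _)
      have h3 := (hψl T (t + h) hth.1 hth.2 u hu (by
        rw [hudef, ← sub_div, abs_div, abs_of_pos hT0]
        gcongr
        push_cast
        rw [add_sub_cancel_left, Nat.cast_natAbs, Int.cast_abs]) s').trans (le_abs_self _)
      refine (add_le_add (mul_le_mul h2 hWl (l2_nonneg _) (abs_nonneg _))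
        (mul_le_mul (hcl s t) h3 (l2_nonneg _) (Real.sqrt_nonneg _))).trans_eq (by ring)
    · rw [lsArray_of_notMem _ hth, covariance_const_right, zero_sub, abs_neg]
      refine (abs_cov_le (hcL s t) (hcL s' (t + h))).trans ((mul_le_mul (hcl s t)
        (hcl s' (t + h)) (l2_nonneg _) (Real.sqrt_nonneg _)).trans ?_)
      exact le_add_of_nonneg_left (by positivity)
  refine squeeze_zero_norm' ((eventually_numNonzero_pos hw).mono hmain) ?_
  have h1 : Tendsto (fun T => |ψ T| * (2 * √(1 + (K : ℝ)))) atTop (𝓝 0) := by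
    simpa using hψ.abs.mul_const (2 * √(1 + (K : ℝ)))
  have h2 : Tendsto (fun T => h.natAbs * (√(1 + (K : ℝ)) * √(1 + K)) / (numNonzero w T : ℝ))
      atTop (𝓝 0) := (tendsto_numNonzero_real hw).const_div_atTop _
  simpa using (h1.add h2).const_mul (Cw ^ 2)

/-- Regroup the double sum by `h = r - t`. The array vanishes outside the window, so the extended
weights contribute nothing there and the sum over `h` may run over all integers. -/
lemma cov_weighted_sum_eq_tsum (hX : LocallyStationaryLinear P ε μ A Alim ϑ B)
    (hf : AdmissibleFunction P ε μ A Alim f CLip δ K) (s s' : S) (T : ℕ) :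
    cov[fun ω => ∑ t ∈ Finset.Icc (1 : ℤ) T, w T t * lsArray ε μ A (f s) T t ω,
      fun ω => ∑ t ∈ Finset.Icc (1 : ℤ) T, w T t * lsArray ε μ A (f s') T t ω; P]
      = ∑' h : ℤ, lagCovLs P ε μ A w (f s) (f s') h T := by
  have hL := fun s => (localApprox_lsArray hX hf s T).memLp
  rw [covariance_fun_sum_fun_sum' (fun t _ => (hL s t).const_mul (w T t))
    (fun t _ => (hL s' t).const_mul (w T t))]
  have hz : ∀ (t : ℤ), ∀ r ∉ Finset.Icc (1 : ℤ) T, extWeight w T r *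
      cov[lsArray ε μ A (f s) T t, lsArray ε μ A (f s') T r; P] = 0 := fun t r hr => by
    rw [lsArray_of_notMem _ (fun h => hr (Finset.mem_Icc.2 h)), covariance_const_right, mul_zero]
  have hsum : ∀ t : ℤ, Summable fun r => extWeight w T r *
      cov[lsArray ε μ A (f s) T t, lsArray ε μ A (f s') T r; P] := fun t =>
    summable_of_ne_finset_zero (hz t)
  have hsum' : ∀ t : ℤ, Summable fun h => w T t * extWeight w T (t + h) *
      cov[lsArray ε μ A (f s) T t, lsArray ε μ A (f s') T (t + h); P] := fun t => by
    simp only [mul_assoc]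
    exact ((Equiv.addLeft t).summable_iff.2 (hsum t)).mul_left _
  unfold lagCovLs
  rw [Summable.tsum_finsetSum fun t _ => hsum' t]
  refine Finset.sum_congr rfl fun t _ => ?_
  simp only [covariance_const_mul_left, covariance_const_mul_right, mul_assoc]
  rw [tsum_mul_left]
  simp only [mul_left_comm _ (w T t)]
  rw [← Finset.mul_sum]
  congr 1
  refine Eq.trans ?_ ((Equiv.addLeft t).tsum_eq (fun r => extWeight w T r *
      cov[lsArray ε μ A (f s) T t, lsArray ε μ A (f s') T r; P])).symm
  rw [tsum_eq_sum (hz t)]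
  refine Finset.sum_congr rfl fun r hr => ?_
  rw [extWeight_of_mem (Finset.mem_Icc.1 hr).1 (Finset.mem_Icc.1 hr).2]

/-- The covariances of the weighted sums converge to the long-run covariance. -/
theorem tendsto_cov_weighted_sum (hX : LocallyStationaryLinear P ε μ A Alim ϑ B)
    (hf : AdmissibleFunction P ε μ A Alim f CLip δ K) (hw : AdmissibleWeights w Cw) {s s' : S}
    (hlim : ∀ h : ℤ, ∃ c : ℝ, Tendsto (lagCov P ε μ Alim w f s s' h) atTop (𝓝 c)) :
    (Summable fun h : ℤ => limUnder atTop (lagCov P ε μ Alim w f s s' h)) ∧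
    Tendsto (fun T : ℕ =>
      cov[fun ω => ∑ t ∈ Finset.Icc (1 : ℤ) T, w T t * lsArray ε μ A (f s) T t ω,
        fun ω => ∑ t ∈ Finset.Icc (1 : ℤ) T, w T t * lsArray ε μ A (f s') T t ω; P])
      atTop (𝓝 (longRunCov P ε μ Alim w f s s')) := by
  have hρ := approxRate_mem hX.rate_mem hf.delta_mem.1
  have hγ : ∀ h : ℤ, Tendsto (lagCovLs P ε μ A w (f s) (f s') h) atTop
      (𝓝 (limUnder atTop (lagCov P ε μ Alim w f s s' h))) := fun h => by
    obtain ⟨c, hc⟩ := hlim h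
    rw [hc.limUnder_eq]
    simpa using (tendsto_lagCovLs_sub_lagCov hX hf hw s s' h).add hc
  have hbs : Summable fun h : ℤ => Cw ^ 2 * (3 * approxConst P ε ϑ B CLip K ^ 2)
      * approxRate ϑ δ ^ gap h := (summable_pow_gap hρ.1.le hρ.2).mul_left _
  -- The bound is only eventual in `T`, since it requires at least one nonzero weight.
  have hb : ∀ᶠ T in atTop, ∀ h : ℤ, ‖lagCovLs P ε μ A w (f s) (f s') h T‖
      ≤ Cw ^ 2 * (3 * approxConst P ε ϑ B CLip K ^ 2) * approxRate ϑ δ ^ gap h :=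
    (eventually_numNonzero_pos hw).mono fun T hn h => abs_lagCovLs_le hX hf hw s s' h hn
  refine ⟨Summable.of_norm_bounded hbs fun h =>
    le_of_tendsto (hγ h).norm (hb.mono fun T hT => hT h), ?_⟩
  simp only [cov_weighted_sum_eq_tsum hX hf]
  exact tendsto_tsum_of_dominated_convergence hbs hγ hb

end LagCovariances

/-! ### Linear combinations and the limit matrix -/

section CramerWold

variable {Ω : Type*} [MeasurableSpace Ω] {P : Measure Ω} {d : ℕ}
  {ε : ℤ → Ω → Fin d → ℝ} {μ : ℝ → Fin d → ℝ}
  {A : ℕ → ℤ → ℤ → Matrix (Fin d) (Fin d) ℝ} {Alim : ℝ → ℤ → Matrix (Fin d) (Fin d) ℝ}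
  {ϑ B : ℝ} {S : Type*} {f : S → (Fin d → ℝ) → ℝ} {CLip δ : ℝ} {K : ℝ≥0}
  {w : ℕ → ℤ → ℝ} {Cw : ℝ} {J : ℕ} {s : Fin J → S}

/-- The linear combination `∑ⱼ aⱼ f(sⱼ, X_{t,T})`. -/
def combArray (ε : ℤ → Ω → Fin d → ℝ) (μ : ℝ → Fin d → ℝ)
    (A : ℕ → ℤ → ℤ → Matrix (Fin d) (Fin d) ℝ) (f : S → (Fin d → ℝ) → ℝ) (s : Fin J → S)
    (a : Fin J → ℝ) (T : ℕ) (t : ℤ) (ω : Ω) : ℝ :=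
  ∑ j, a j * lsArray ε μ A (f (s j)) T t ω

/-- The long-run covariance matrix. -/
abbrev longRunMatrix (P : Measure Ω) (ε : ℤ → Ω → Fin d → ℝ) (μ : ℝ → Fin d → ℝ)
    (Alim : ℝ → ℤ → Matrix (Fin d) (Fin d) ℝ) (w : ℕ → ℤ → ℝ) (f : S → (Fin d → ℝ) → ℝ)
    (s : Fin J → S) : Matrix (Fin J) (Fin J) ℝ :=
  Matrix.of fun i j : Fin J => longRunCov P ε μ Alim w f (s i) (s j)

lemma weightedSum_eq (s : S) (T : ℕ) (ω : Ω) :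
    weightedSum P ε μ A w f s T ω = ∑ t ∈ Finset.Icc (1 : ℤ) T,
      w T t * (lsArray ε μ A (f s) T t ω - ∫ ω', lsArray ε μ A (f s) T t ω' ∂P) := by
  refine Finset.sum_congr rfl fun t ht => ?_
  rw [lsArray_of_mem _ (Finset.mem_Icc.1 ht)]

variable [IsProbabilityMeasure P]

lemma localApprox_combArray (hX : LocallyStationaryLinear P ε μ A Alim ϑ B)
    (hf : AdmissibleFunction P ε μ A Alim f CLip δ K) (s : Fin J → S) (a : Fin J → ℝ) (T : ℕ) :
    LocalApprox P ε (combArray ε μ A f s a T)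
      (fun M t ω => ∑ j, a j * lsArrayLocal ε μ A ϑ (f (s j)) T M t ω)
      (fun M => ∑ j, |a j| * clampLevel ϑ M) (∑ j, |a j| * approxConst P ε ϑ B CLip K)
      (approxRate ϑ δ) :=
  LocalApprox.finset_sum hX.measurable_innov Finset.univ fun j _ =>
    (localApprox_lsArray hX hf (s j) T).const_mul (a j)

lemma sum_mul_weightedSum (hX : LocallyStationaryLinear P ε μ A Alim ϑ B)
    (hf : AdmissibleFunction P ε μ A Alim f CLip δ K) (a : Fin J → ℝ) (T : ℕ) (ω : Ω) :
    ∑ j, a j * weightedSum P ε μ A w f (s j) T ω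
      = ∑ t ∈ Finset.Icc (1 : ℤ) T,
        w T t * (combArray ε μ A f s a T t ω - ∫ ω', combArray ε μ A f s a T t ω' ∂P) := by
  simp only [weightedSum_eq, Finset.mul_sum]
  rw [Finset.sum_comm]
  refine Finset.sum_congr rfl fun t _ => ?_
  unfold combArray
  rw [integral_finsetSum _ fun j _ => (((localApprox_lsArray hX hf (s j) T).memLp t).const_mul
    (a j)).integrable one_le_two, ← Finset.sum_sub_distrib, Finset.mul_sum]
  refine Finset.sum_congr rfl fun j _ => ?_
  rw [integral_const_mul]
  ring

lemma integral_sq_combArray (hX : LocallyStationaryLinear P ε μ A Alim ϑ B)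
    (hf : AdmissibleFunction P ε μ A Alim f CLip δ K) (a : Fin J → ℝ) (T : ℕ) :
    ∫ ω, (∑ t ∈ Finset.Icc (1 : ℤ) T,
        w T t * (combArray ε μ A f s a T t ω - ∫ ω', combArray ε μ A f s a T t ω' ∂P)) ^ 2 ∂P
      = ∑ i, ∑ j, a i * a j *
        cov[fun ω => ∑ t ∈ Finset.Icc (1 : ℤ) T, w T t * lsArray ε μ A (f (s i)) T t ω,
          fun ω => ∑ t ∈ Finset.Icc (1 : ℤ) T, w T t * lsArray ε μ A (f (s j)) T t ω; P] := by
  have hL := fun j => (localApprox_lsArray hX hf (s j) T).memLp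
  have hS : ∀ j, MemLp (fun ω => ∑ t ∈ Finset.Icc (1 : ℤ) T,
      w T t * lsArray ε μ A (f (s j)) T t ω) 2 P := fun j =>
    memLp_finsetSum _ fun t _ => (hL j t).const_mul _
  have hZ := (localApprox_combArray hX hf s a T).memLp
  have hZS : MemLp (fun ω => ∑ t ∈ Finset.Icc (1 : ℤ) T, w T t * combArray ε μ A f s a T t ω) 2 P :=
    memLp_finsetSum _ fun t _ => (hZ t).const_mul _
  have e1 : ∀ ω, ∑ t ∈ Finset.Icc (1 : ℤ) T,
      w T t * (combArray ε μ A f s a T t ω - ∫ ω', combArray ε μ A f s a T t ω' ∂P)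
      = ∑ t ∈ Finset.Icc (1 : ℤ) T, w T t * combArray ε μ A f s a T t ω
        - ∫ ω', ∑ t ∈ Finset.Icc (1 : ℤ) T, w T t * combArray ε μ A f s a T t ω' ∂P := fun ω => by
    rw [integral_finsetSum _ fun t _ => ((hZ t).const_mul _).integrable one_le_two,
      ← Finset.sum_sub_distrib]
    exact Finset.sum_congr rfl fun t _ => by rw [integral_const_mul, mul_sub]
  simp only [e1]
  have hae := hZS.aestronglyMeasurable.aemeasurable
  rw [← variance_eq_integral hae, ← covariance_self hae]
  have e2 : (fun ω => ∑ t ∈ Finset.Icc (1 : ℤ) T, w T t * combArray ε μ A f s a T t ω)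
      = fun ω => ∑ j, a j * ∑ t ∈ Finset.Icc (1 : ℤ) T,
        w T t * lsArray ε μ A (f (s j)) T t ω := by
    ext ω
    simp only [combArray, Finset.mul_sum]
    rw [Finset.sum_comm]
    exact Finset.sum_congr rfl fun j _ => Finset.sum_congr rfl fun t _ => by ring
  rw [e2, covariance_fun_sum_fun_sum (fun j => (hS j).const_mul _) (fun j => (hS j).const_mul _)]
  refine Finset.sum_congr rfl fun i _ => Finset.sum_congr rfl fun j _ => ?_
  rw [covariance_const_mul_left, covariance_const_mul_right, mul_assoc]

lemma tendsto_integral_sq_combArray (hX : LocallyStationaryLinear P ε μ A Alim ϑ B)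
    (hf : AdmissibleFunction P ε μ A Alim f CLip δ K) (hw : AdmissibleWeights w Cw)
    (hlim : ∀ (i j : Fin J) (h : ℤ),
      ∃ c : ℝ, Tendsto (lagCov P ε μ Alim w f (s i) (s j) h) atTop (𝓝 c)) (a : Fin J → ℝ) :
    Tendsto (fun T : ℕ => ∫ ω, (∑ t ∈ Finset.Icc (1 : ℤ) T,
        w T t * (combArray ε μ A f s a T t ω - ∫ ω', combArray ε μ A f s a T t ω' ∂P)) ^ 2 ∂P)
      atTop (𝓝 (a ⬝ᵥ longRunMatrix P ε μ Alim w f s *ᵥ a)) := by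
  simp only [integral_sq_combArray hX hf]
  have e : a ⬝ᵥ longRunMatrix P ε μ Alim w f s *ᵥ a
      = ∑ i, ∑ j, a i * a j * longRunCov P ε μ Alim w f (s i) (s j) := by
    simp only [dotProduct, Matrix.mulVec, Matrix.of_apply, Finset.mul_sum]
    exact Finset.sum_congr rfl fun i _ => Finset.sum_congr rfl fun j _ => by ring
  rw [e]
  exact tendsto_finsetSum _ fun i _ => tendsto_finsetSum _ fun j _ =>
    (tendsto_cov_weighted_sum hX hf hw (hlim i j)).2.const_mul _

/-- Each entry is a limit of covariances, which gives symmetry, and each value of the quadratic form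
is a limit of variances. -/
lemma posSemidef_longRunMatrix (hX : LocallyStationaryLinear P ε μ A Alim ϑ B)
    (hf : AdmissibleFunction P ε μ A Alim f CLip δ K) (hw : AdmissibleWeights w Cw)
    (hlim : ∀ (i j : Fin J) (h : ℤ),
      ∃ c : ℝ, Tendsto (lagCov P ε μ Alim w f (s i) (s j) h) atTop (𝓝 c)) :
    (longRunMatrix P ε μ Alim w f s).PosSemidef := by
  refine Matrix.PosSemidef.of_dotProduct_mulVec_nonneg ?_ fun a => ?_
  · ext i j
    simp only [Matrix.conjTranspose_apply, Matrix.of_apply, star_trivial]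
    refine tendsto_nhds_unique (tendsto_cov_weighted_sum hX hf hw (hlim j i)).2 ?_
    simp only [covariance_comm (fun ω => ∑ t ∈ _, _ * lsArray ε μ A (f (s j)) _ t ω)]
    exact (tendsto_cov_weighted_sum hX hf hw (hlim i j)).2
  · rw [star_trivial]
    exact ge_of_tendsto' (tendsto_integral_sq_combArray hX hf hw hlim a)
      fun T => integral_nonneg fun _ => sq_nonneg _

lemma tendsto_charFun_combArray (hX : LocallyStationaryLinear P ε μ A Alim ϑ B)
    (hf : AdmissibleFunction P ε μ A Alim f CLip δ K) (hw : AdmissibleWeights w Cw)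
    (hlim : ∀ (i j : Fin J) (h : ℤ),
      ∃ c : ℝ, Tendsto (lagCov P ε μ Alim w f (s i) (s j) h) atTop (𝓝 c)) (a : Fin J → ℝ) :
    Tendsto (fun T : ℕ => ∫ ω, Complex.exp ((∑ t ∈ Finset.Icc (1 : ℤ) T, w T t *
        (combArray ε μ A f s a T t ω - ∫ ω', combArray ε μ A f s a T t ω' ∂P) : ℝ)
          * Complex.I) ∂P)
      atTop (𝓝 (Real.exp (-((a ⬝ᵥ longRunMatrix P ε μ Alim w f s *ᵥ a) / 2)) : ℝ)) := by
  -- Summing over nonzero weights only makes the cardinality equal to `d_T`, as the weight bound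
  -- requires.
  set I : ℕ → Finset ℤ := fun T => {t ∈ Finset.Icc (1 : ℤ) (T : ℤ) | w T t ≠ 0} with hI
  have hsum : ∀ (T : ℕ) (g : ℤ → ℝ), ∑ t ∈ I T, w T t * g t
      = ∑ t ∈ Finset.Icc (1 : ℤ) T, w T t * g t := fun T g => by
    refine Finset.sum_subset (Finset.filter_subset _ _) fun t ht ht' => ?_
    have : w T t = 0 := by
      by_contra h0
      exact ht' (Finset.mem_filter.2 ⟨ht, h0⟩)
    rw [this, zero_mul]
  have h1 := tendsto_charFun_weighted_sum hX.measurable_innov hX.indep_innov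
    (approxRate_mem hX.rate_mem hf.delta_mem.1) (localApprox_combArray hX hf s a) (I := I) (w := w)
    (abs_nonneg Cw) (fun T t ht => by
      have ht' := Finset.mem_Icc.1 (Finset.mem_filter.1 ht).1
      rw [abs_of_nonneg (hw.nonneg T t ht'.1 ht'.2)]
      refine (hw.bound T t ht'.1 ht'.2).trans ?_
      exact div_le_div_of_nonneg_right (le_abs_self _) (Real.sqrt_nonneg _))
    hw.tendsto_numNonzero
  simp only [hsum] at h1
  have h2 := (Complex.continuous_ofReal.tendsto _).comp ((Real.continuous_exp.tendsto _).comp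
    ((tendsto_integral_sq_combArray hX hf hw hlim a).div_const 2).neg)
  simpa using h1.add h2

end CramerWold

end

theorem mainTheorem1 {Ω : Type*} [MeasurableSpace Ω] (P : Measure Ω) [IsProbabilityMeasure P]
    {d : ℕ} (ε : ℤ → Ω → Fin d → ℝ) (μ : ℝ → Fin d → ℝ)
    (A : ℕ → ℤ → ℤ → Matrix (Fin d) (Fin d) ℝ) (Alim : ℝ → ℤ → Matrix (Fin d) (Fin d) ℝ)
    (ϑ B : ℝ) (hX : LocallyStationaryLinear P ε μ A Alim ϑ B)
    (w : ℕ → ℤ → ℝ) (Cw : ℝ) (hw : AdmissibleWeights w Cw)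
    (S : Set (Fin d → EReal)) (ρ : PseudoMetricSpace S)
    (hS : @CompactSpace S ρ.toUniformSpace.toTopologicalSpace)
    (f : S → (Fin d → ℝ) → ℝ) (CLip δ : ℝ) (K : ℝ≥0)
    (hf : AdmissibleFunction P ε μ A Alim f CLip δ K)
    (J : ℕ) (s : Fin J → S)
    (hlim : ∀ (i j : Fin J) (h : ℤ),
      ∃ c : ℝ, Tendsto (lagCov P ε μ Alim w f (s i) (s j) h) atTop (𝓝 c)) :
    (∀ i j : Fin J,
      Summable fun h : ℤ => limUnder atTop (lagCov P ε μ Alim w f (s i) (s j) h)) ∧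
    (Matrix.of fun i j : Fin J => longRunCov P ε μ Alim w f (s i) (s j)).PosSemidef ∧
    TendstoInDistribution
      (fun (T : ℕ) (ω : Ω) =>
        WithLp.toLp 2 fun j : Fin J => weightedSum P ε μ A w f (s j) T ω)
      atTop
      (id : EuclideanSpace ℝ (Fin J) → EuclideanSpace ℝ (Fin J))
      (fun _ => P)
      (multivariateGaussian 0
        (Matrix.of fun i j : Fin J => longRunCov P ε μ Alim w f (s i) (s j))) := by
  have hpsd := posSemidef_longRunMatrix hX hf hw hlim
  have hmeas : ∀ T : ℕ, Measurable fun ω : Ω =>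
      WithLp.toLp 2 fun j : Fin J => weightedSum P ε μ A w f (s j) T ω := fun T => by
    refine (WithLp.measurable_toLp 2 _).comp (measurable_pi_lambda _ fun j => ?_)
    exact Finset.measurable_fun_sum _ fun t _ => (((hf.measurable (s j)).comp
      (measurable_lsProcess hX T t)).sub_const _).const_mul _
  refine ⟨fun i j => (tendsto_cov_weighted_sum hX hf hw (hlim i j)).1, hpsd,
    fun T => (hmeas T).aemeasurable, aemeasurable_id, ?_⟩
  -- Lévy continuity; the frequency `a` is absorbed into the coefficients of `combArray`, so
  -- characteristic functions at `1` suffice.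
  refine ProbabilityMeasure.tendsto_of_tendsto_charFun fun a => ?_
  have hlimit : charFun ((multivariateGaussian 0 (longRunMatrix P ε μ Alim w f s)).map id) a
      = (Real.exp (-((a.ofLp ⬝ᵥ longRunMatrix P ε μ Alim w f s *ᵥ a.ofLp) / 2)) : ℝ) := by
    rw [Measure.map_id, charFun_multivariateGaussian hpsd]
    push_cast
    simp
  have hpre : ∀ T : ℕ, charFun (P.map fun ω : Ω =>
      WithLp.toLp 2 fun j : Fin J => weightedSum P ε μ A w f (s j) T ω) a
      = ∫ ω, Complex.exp ((∑ t ∈ Finset.Icc (1 : ℤ) T, w T t *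
        (combArray ε μ A f s a.ofLp T t ω - ∫ ω', combArray ε μ A f s a.ofLp T t ω' ∂P) : ℝ)
          * Complex.I) ∂P := fun T => by
    rw [charFun_apply, integral_map (hmeas T).aemeasurable (by fun_prop)]
    refine integral_congr_ae (.of_forall fun ω => ?_)
    simp only [← sum_mul_weightedSum hX hf, PiLp.inner_apply, RCLike.inner_apply, conj_trivial]
  have h := tendsto_charFun_combArray hX hf hw hlim a.ofLp
  simp only [← hpre] at h
  rw [← hlimit] at h
  exact h
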